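/- Let $\mathbb{T}=\mathbb{R}/2\pi\mathbb{Z}$ and let $M=\mathbb{R}^2\times\mathbb{T}$ with coordinates $x,y\in\mathbb{R}$, $\theta\in\mathbb{T}$, be endowed with the Poisson structure $\Pi=(x\partial_x+\partial_\theta)\wedge\partial_y$, that is, $$\{f,g\}=(xf_x+f_\theta)\,g_y-f_y\,(xg_x+g_\theta).$$ A vector field $X$ is Poisson if $X\{f,g\}=\{Xf,g\}+\{f,Xg\}$ for all $f,g\in C^\infty(M)$; the Hamiltonian vector field of $h\in C^\infty(M)$ is $X_h=\{\cdot,h\}$, and $H^1_\Pi(M)$ is the space of Poisson vector fields modulo Hamiltonian vector fields. For a vector field $X$ and $\beta>0$ let $\mathrm{KMS}(X,\beta)$ be the convex cone of positive linear functionals $\varphi\colon C_c^\infty(M)\to\mathbb{C}$ such that $\varphi(\{f,g\})=\beta\,\varphi(gX(f))$ for all $f,g\in C^\infty_c(M)$, and let $\mathrm{KMS}(M,\Pi)$ be the convex cone of positive $\Pi$-traces, i.e. of positive linear functionals with $\varphi(\{f,g\})=0$ for all $f,g\in C_c^\infty(M)$. Let $\mathcal{M}_+(\mathbb{T})$ be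 the convex cone of finite positive Borel measures on $\mathbb{T}$. A nonzero element $\varphi$ of a convex cone $C$ is called extremal if $\varphi=\varphi_1+\varphi_2$ with $\varphi_1,\varphi_2\in C$ implies $\varphi_1=\lambda_1\varphi$ and $\varphi_2=\lambda_2\varphi$ for some $\lambda_1,\lambda_2\ge 0$. Let $\beta>0$. Then the following hold. (a) Let $A,B\in\mathbb{R}$ and let $X$ be any Poisson vector field with $[X]=[A\partial_\theta+B\partial_y]\in H^1_\Pi(M)$. If $B<0$, then $\mathrm{KMS}(X,\beta)=\{0\}$. If $B=0$, then $\mathrm{KMS}(X,\beta)\simeq[0,+\infty)$. If $B>0$ and $A\neq0$, then $\mathrm{KMS}(X,\beta)=\{0\}$. If $B>0$ and $A=0$, then $\mathrm{KMS}(X,\beta)\simeq\mathcal{M}_+(\mathbb{T})^2$. Here $\simeq$ denotes isomorphism of convex cones. (b) For every $A\in\mathbb{R}$, $\mathrm{KMS}(A\partial_\theta,\beta)$ is the ray of all multiples $c\varphi$, $c\ge0$, of the nonzero functional $$\varphi(f)=\int_0^{2\pi}\int_{\mathbb{R}}f(0,\theta,y)\,e^{-A\beta y}\,\mathrm{d}y\,\mathrm{d}\theta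 .$$ (c) $\mathrm{KMS}(M,\Pi)$ is the ray of all multiples $c\varphi$, $c\ge0$, of the nonzero functional $\varphi(f)=\int_0^{2\pi}\int_{\mathbb{R}}f(0,\theta,y)\,\mathrm{d}y\,\mathrm{d}\theta$. (d) Let $B>0$ and put $\gamma=B\beta$ (so $\gamma=\beta$ for the dynamics $\partial_y$). For $x\neq0$ and $\theta\in\mathbb{T}$ the formula $${}_x\varphi_\theta^{\gamma}(f)=\int_{\mathbb{R}^2}f(xe^u,\theta+u,y)\,e^{\gamma u}\,\mathrm{d}u\,\mathrm{d}y,\qquad f\in C_c^\infty(M),$$ in which the integral converges absolutely, defines an element of $\mathrm{KMS}(B\partial_y,\beta)$. The map $(\nu^+,\nu^-)\mapsto\varphi$, $$\varphi(f)=\int_{\mathbb{T}}{}_{1}\varphi_\theta^{\gamma}(f)\,\mathrm{d}\nu^+(\theta)+\int_{\mathbb{T}}{}_{-1}\varphi_\theta^{\gamma}(f)\,\mathrm{d}\nu^-(\theta),$$ is a well-defined isomorphism of convex cones $\mathcal{M}_+(\mathbb{T})^2\to\mathrm{KMS}(B\partial_y,\beta)$. A functional $\varphi$ is an extremal element of $\mathrm{KMS}(B\partial_y,\beta)$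 if and only if $\varphi=c\;{}_{1}\varphi_\theta^{\gamma}$ or $\varphi=c\;{}_{-1}\varphi_\theta^{\gamma}$ for some $c>0$ and $\theta\in\mathbb{T}$. -/

import Mathlib

open scoped ContDiff ComplexOrder NNReal
open MeasureTheory

namespace Spiral

/-- The circle `𝕋 = ℝ / 2πℤ`. -/
abbrev T : Type := AddCircle (2 * Real.pi)

/-- The manifold `M = ℝ² × 𝕋`; its points are written `(x, θ, y)`. -/
abbrev M : Type := ℝ × T × ℝ

section Functions

variable {𝕜 : Type*} [RCLike 𝕜]

/-- The pullback of a function on `M` along the universal covering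
`ℝ³ → M`, `(x, t, y) ↦ (x, t mod 2π, y)`. -/
noncomputable def lift (f : M → 𝕜) (p : ℝ × ℝ × ℝ) : 𝕜 := f (p.1, (p.2.1 : T), p.2.2)

/-- Smoothness on `M`. As the covering `ℝ³ → M` is a surjective local diffeomorphism, a function
on `M` is smooth exactly if its pullback to `ℝ³` is. -/
def IsSmooth (f : M → 𝕜) : Prop := ContDiff ℝ ∞ (lift f)

/-- `∂f/∂x`. -/
noncomputable def dx (f : M → 𝕜) (p : M) : 𝕜 :=
  deriv (fun s : ℝ => f (p.1 + s, p.2.1, p.2.2)) 0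

/-- `∂f/∂θ`. -/
noncomputable def dθ (f : M → 𝕜) (p : M) : 𝕜 :=
  deriv (fun s : ℝ => f (p.1, p.2.1 + (s : T), p.2.2)) 0

/-- `∂f/∂y`. -/
noncomputable def dy (f : M → 𝕜) (p : M) : 𝕜 :=
  deriv (fun s : ℝ => f (p.1, p.2.1, p.2.2 + s)) 0

/-- The vector field `x ∂_x + ∂_θ`, applied to a function. -/
noncomputable def spiralDeriv (f : M → 𝕜) (p : M) : 𝕜 := (p.1 : 𝕜) * dx f p + dθ f p

/-- The Poisson bracket `{f, g} = Π(df, dg)` of `Π = (x ∂_x + ∂_θ) ∧ ∂_y`. -/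
noncomputable def bracket (f g : M → 𝕜) (p : M) : 𝕜 :=
  spiralDeriv f p * dy g p - dy f p * spiralDeriv g p

/-! Partial derivatives, read on the universal covering. -/

theorem continuous_lift_iff {f : M → 𝕜} : Continuous (lift f) ↔ Continuous f := by
  have hq : IsOpenQuotientMap (fun t : ℝ => (t : T)) := QuotientAddGroup.isOpenQuotientMap_mk
  have h : IsOpenQuotientMap (Prod.map id (Prod.map (fun t : ℝ => (t : T)) id) :
      ℝ × ℝ × ℝ → M) := IsOpenQuotientMap.id.prodMap (hq.prodMap IsOpenQuotientMap.id)
  exact h.isQuotientMap.continuous_iff.symm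

theorem IsSmooth.hasFDerivAt {f : M → 𝕜} (hf : IsSmooth f) (q : ℝ × ℝ × ℝ) :
    HasFDerivAt (lift f) (fderiv ℝ (lift f) q) q :=
  (hf.differentiable (by simp) q).hasFDerivAt

theorem deriv_line {f : M → 𝕜} (hf : IsSmooth f) (q v : ℝ × ℝ × ℝ) :
    HasDerivAt (fun s : ℝ => lift f (q + s • v)) (fderiv ℝ (lift f) q v) 0 := by
  have h1 : HasDerivAt (fun s : ℝ => q + s • v) v 0 := by
    simpa using ((hasDerivAt_id (0 : ℝ)).smul_const v).const_add q
  have h2 : HasFDerivAt (lift f) (fderiv ℝ (lift f) q) (q + (0 : ℝ) • v) := by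
    simpa using hf.hasFDerivAt q
  exact h2.comp_hasDerivAt 0 h1

theorem lift_dx {f : M → 𝕜} (hf : IsSmooth f) (q : ℝ × ℝ × ℝ) :
    lift (dx f) q = fderiv ℝ (lift f) q (1, 0, 0) := by
  rw [← (deriv_line hf q (1, 0, 0)).deriv]
  simp [lift, dx]

theorem lift_dθ {f : M → 𝕜} (hf : IsSmooth f) (q : ℝ × ℝ × ℝ) :
    lift (dθ f) q = fderiv ℝ (lift f) q (0, 1, 0) := by
  rw [← (deriv_line hf q (0, 1, 0)).deriv]
  simp [lift, dθ]

theorem lift_dy {f : M → 𝕜} (hf : IsSmooth f) (q : ℝ × ℝ × ℝ) :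
    lift (dy f) q = fderiv ℝ (lift f) q (0, 0, 1) := by
  rw [← (deriv_line hf q (0, 0, 1)).deriv]
  simp [lift, dy]

theorem smooth_fderiv {f : M → 𝕜} (hf : IsSmooth f) (v : ℝ × ℝ × ℝ) :
    ContDiff ℝ ∞ (fun q => fderiv ℝ (lift f) q v) :=
  (ContDiff.fderiv_right hf (m := ∞) (by simp)).clm_apply contDiff_const

theorem IsSmooth.dx {f : M → 𝕜} (hf : IsSmooth f) : IsSmooth (dx f) := by
  unfold IsSmooth
  rw [funext (lift_dx hf)]
  exact smooth_fderiv hf _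

theorem IsSmooth.dθ {f : M → 𝕜} (hf : IsSmooth f) : IsSmooth (dθ f) := by
  unfold IsSmooth
  rw [funext (lift_dθ hf)]
  exact smooth_fderiv hf _

theorem IsSmooth.dy {f : M → 𝕜} (hf : IsSmooth f) : IsSmooth (dy f) := by
  unfold IsSmooth
  rw [funext (lift_dy hf)]
  exact smooth_fderiv hf _

theorem IsSmooth.add {f g : M → 𝕜} (hf : IsSmooth f) (hg : IsSmooth g) : IsSmooth (f + g) :=
  ContDiff.add hf hg

theorem IsSmooth.sub {f g : M → 𝕜} (hf : IsSmooth f) (hg : IsSmooth g) : IsSmooth (f - g) :=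
  ContDiff.sub hf hg

theorem IsSmooth.mul {f g : M → 𝕜} (hf : IsSmooth f) (hg : IsSmooth g) : IsSmooth (f * g) :=
  ContDiff.mul hf hg

theorem isSmooth_const (c : 𝕜) : IsSmooth (fun _ : M => c) := contDiff_const

theorem IsSmooth.ofReal {f : M → ℝ} (hf : IsSmooth f) : IsSmooth (fun p => (f p : 𝕜)) :=
  (RCLike.ofRealCLM (K := 𝕜)).contDiff.comp hf

theorem isSmooth_x : IsSmooth (fun p : M => p.1) := contDiff_fst

theorem IsSmooth.spiralDeriv {f : M → 𝕜} (hf : IsSmooth f) : IsSmooth (spiralDeriv f) :=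
  (isSmooth_x.ofReal.mul hf.dx).add hf.dθ

theorem IsSmooth.bracket {f g : M → 𝕜} (hf : IsSmooth f) (hg : IsSmooth g) :
    IsSmooth (bracket f g) :=
  (hf.spiralDeriv.mul hg.dy).sub (hf.dy.mul hg.spiralDeriv)

end Functions

/-- `C^∞(M)`, the space of real smooth functions. -/
def CInf : Submodule ℝ (M → ℝ) where
  carrier := {f | IsSmooth f}
  zero_mem' := isSmooth_const 0
  add_mem' := IsSmooth.add
  smul_mem' c _ hf := (isSmooth_const c).mul hf

/-- The constant function `1`. -/
def oneC : CInf := ⟨fun _ => 1, isSmooth_const 1⟩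

/-- Smooth vector fields on `M`. The tangent bundle of `M` has the global frame
`∂_x, ∂_θ, ∂_y`; the triple `(ξ, τ, η)` stands for `ξ ∂_x + τ ∂_θ + η ∂_y`. -/
abbrev VF : Type := CInf × CInf × CInf

/-- `X(f)` for a vector field `X = ξ ∂_x + τ ∂_θ + η ∂_y`. -/
noncomputable def VF.app {𝕜 : Type*} [RCLike 𝕜] (X : VF) (f : M → 𝕜) (p : M) : 𝕜 :=
  ((X.1 : M → ℝ) p : 𝕜) * dx f p + ((X.2.1 : M → ℝ) p : 𝕜) * dθ f p
    + ((X.2.2 : M → ℝ) p : 𝕜) * dy f p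

theorem IsSmooth.app {𝕜 : Type*} [RCLike 𝕜] {f : M → 𝕜} (hf : IsSmooth f) (X : VF) :
    IsSmooth (X.app f) :=
  (((IsSmooth.ofReal X.1.2).mul hf.dx).add ((IsSmooth.ofReal X.2.1.2).mul hf.dθ)).add
    ((IsSmooth.ofReal X.2.2.2).mul hf.dy)

/-- The vector field `∂_θ`. -/
def vθ : VF := (0, oneC, 0)

/-- The vector field `∂_y`. -/
def vy : VF := (0, 0, oneC)

/-- The Hamiltonian vector field `X_h = {·, h} = h_y (x ∂_x + ∂_θ) - (x h_x + h_θ) ∂_y`. -/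
noncomputable def ham (h : CInf) : VF :=
  (⟨fun p => p.1 * dy h.1 p, isSmooth_x.mul h.2.dy⟩, ⟨dy h.1, h.2.dy⟩,
    -⟨spiralDeriv h.1, h.2.spiralDeriv⟩)

theorem ham_app {𝕜 : Type*} [RCLike 𝕜] (h : CInf) (f : M → 𝕜) (p : M) :
    (ham h).app f p = ((dy h.1 p : ℝ) : 𝕜) * spiralDeriv f p
      - dy f p * ((spiralDeriv h.1 p : ℝ) : 𝕜) := by
  simp only [VF.app, ham, spiralDeriv]
  push_cast
  simp [spiralDeriv]
  ring

theorem ham_app_real (h : CInf) (f : M → ℝ) (p : M) : (ham h).app f p = bracket f h.1 p := by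
  rw [ham_app]; simp [bracket]; ring


/-! Product and commutation rules. -/

section Rules

variable {f g : M → ℝ}

theorem exists_lift (p : M) : ∃ q : ℝ × ℝ × ℝ, p = (q.1, (q.2.1 : T), q.2.2) := by
  obtain ⟨x, θ, y⟩ := p
  obtain ⟨t, rfl⟩ := QuotientAddGroup.mk_surjective θ
  exact ⟨(x, t, y), rfl⟩

theorem lift_injective : Function.Injective (lift : (M → ℝ) → ℝ × ℝ × ℝ → ℝ) := by
  intro f g h
  funext p
  obtain ⟨q, rfl⟩ := exists_lift p
  exact congrFun h q

theorem fderiv_lift_mul (hf : IsSmooth f) (hg : IsSmooth g) (q v : ℝ × ℝ × ℝ) :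
    fderiv ℝ (lift (f * g)) q v
      = fderiv ℝ (lift f) q v * lift g q + lift f q * fderiv ℝ (lift g) q v := by
  have h := ((hf.hasFDerivAt q).mul (hg.hasFDerivAt q)).fderiv
  have e : lift (f * g) = lift f * lift g := rfl
  rw [e, h]
  simp
  ring

theorem fderiv_lift_add (hf : IsSmooth f) (hg : IsSmooth g) (q v : ℝ × ℝ × ℝ) :
    fderiv ℝ (lift (f + g)) q v = fderiv ℝ (lift f) q v + fderiv ℝ (lift g) q v := by
  have h := ((hf.hasFDerivAt q).add (hg.hasFDerivAt q)).fderiv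
  have e : lift (f + g) = lift f + lift g := rfl
  rw [e, h]
  rfl

theorem fderiv_lift_comm (hf : IsSmooth f) (v w q : ℝ × ℝ × ℝ) :
    fderiv ℝ (fun r => fderiv ℝ (lift f) r v) q w
      = fderiv ℝ (fun r => fderiv ℝ (lift f) r w) q v := by
  have hd : DifferentiableAt ℝ (fderiv ℝ (lift f)) q :=
    (ContDiff.fderiv_right hf (m := ∞) (by simp)).differentiable (by simp) q
  have hs : IsSymmSndFDerivAt ℝ (lift f) q :=
    (ContDiff.contDiffAt hf).isSymmSndFDerivAt (by simpa using ENat.LEInfty.out)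
  rw [fderiv_clm_apply hd (differentiableAt_const v),
    fderiv_clm_apply hd (differentiableAt_const w)]
  simpa using hs w v

theorem dx_mul (hf : IsSmooth f) (hg : IsSmooth g) : dx (f * g) = dx f * g + f * dx g := by
  apply lift_injective; funext q
  rw [lift_dx (hf.mul hg), fderiv_lift_mul hf hg, ← lift_dx hf, ← lift_dx hg]; rfl

theorem dθ_mul (hf : IsSmooth f) (hg : IsSmooth g) : dθ (f * g) = dθ f * g + f * dθ g := by
  apply lift_injective; funext q
  rw [lift_dθ (hf.mul hg), fderiv_lift_mul hf hg, ← lift_dθ hf, ← lift_dθ hg]; rfl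

theorem dy_mul (hf : IsSmooth f) (hg : IsSmooth g) : dy (f * g) = dy f * g + f * dy g := by
  apply lift_injective; funext q
  rw [lift_dy (hf.mul hg), fderiv_lift_mul hf hg, ← lift_dy hf, ← lift_dy hg]; rfl

theorem dx_add (hf : IsSmooth f) (hg : IsSmooth g) : dx (f + g) = dx f + dx g := by
  apply lift_injective; funext q
  rw [lift_dx (hf.add hg), fderiv_lift_add hf hg, ← lift_dx hf, ← lift_dx hg]; rfl

theorem dθ_add (hf : IsSmooth f) (hg : IsSmooth g) : dθ (f + g) = dθ f + dθ g := by
  apply lift_injective; funext q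
  rw [lift_dθ (hf.add hg), fderiv_lift_add hf hg, ← lift_dθ hf, ← lift_dθ hg]; rfl

theorem dy_add (hf : IsSmooth f) (hg : IsSmooth g) : dy (f + g) = dy f + dy g := by
  apply lift_injective; funext q
  rw [lift_dy (hf.add hg), fderiv_lift_add hf hg, ← lift_dy hf, ← lift_dy hg]; rfl

theorem dθ_dx (hf : IsSmooth f) : dθ (dx f) = dx (dθ f) := by
  apply lift_injective; funext q
  rw [lift_dθ hf.dx, lift_dx hf.dθ, funext (lift_dx hf), funext (lift_dθ hf),
    fderiv_lift_comm hf]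

theorem dy_dx (hf : IsSmooth f) : dy (dx f) = dx (dy f) := by
  apply lift_injective; funext q
  rw [lift_dy hf.dx, lift_dx hf.dy, funext (lift_dx hf), funext (lift_dy hf),
    fderiv_lift_comm hf]

theorem dy_dθ (hf : IsSmooth f) : dy (dθ f) = dθ (dy f) := by
  apply lift_injective; funext q
  rw [lift_dy hf.dθ, lift_dθ hf.dy, funext (lift_dθ hf), funext (lift_dy hf),
    fderiv_lift_comm hf]

theorem dx_smul (c : ℝ) : dx (c • f) = c • dx f := by
  funext p; simp [dx]

theorem dθ_smul (c : ℝ) : dθ (c • f) = c • dθ f := by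
  funext p; simp [dθ]

theorem dy_smul (c : ℝ) : dy (c • f) = c • dy f := by
  funext p; simp [dy]

theorem IsSmooth.smul (c : ℝ) (hf : IsSmooth f) : IsSmooth (c • f) :=
  (isSmooth_const c).mul hf

theorem spiralDeriv_eq : spiralDeriv f = (fun p : M => p.1) * dx f + dθ f := rfl

theorem bracket_eq : bracket f g = spiralDeriv f * dy g + (-1 : ℝ) • (dy f * spiralDeriv g) := by
  funext p; simp [bracket]; ring

theorem spiralDeriv_add (hf : IsSmooth f) (hg : IsSmooth g) :
    spiralDeriv (f + g) = spiralDeriv f + spiralDeriv g := by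
  simp only [spiralDeriv_eq, dx_add hf hg, dθ_add hf hg]; ring

theorem spiralDeriv_smul (c : ℝ) : spiralDeriv (c • f) = c • spiralDeriv f := by
  simp only [spiralDeriv_eq, dx_smul, dθ_smul, smul_add, mul_smul_comm]

theorem spiralDeriv_mul (hf : IsSmooth f) (hg : IsSmooth g) :
    spiralDeriv (f * g) = spiralDeriv f * g + f * spiralDeriv g := by
  simp only [spiralDeriv_eq, dx_mul hf hg, dθ_mul hf hg]; ring

theorem dθ_spiralDeriv (hf : IsSmooth f) : dθ (spiralDeriv f) = spiralDeriv (dθ f) := by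
  have h : dθ (fun p : M => p.1) = 0 := by funext p; simp [dθ]
  rw [spiralDeriv_eq, spiralDeriv_eq, dθ_add (isSmooth_x.mul hf.dx) hf.dθ,
    dθ_mul isSmooth_x hf.dx, h, dθ_dx hf]
  ring

theorem dy_spiralDeriv (hf : IsSmooth f) : dy (spiralDeriv f) = spiralDeriv (dy f) := by
  have h : dy (fun p : M => p.1) = 0 := by funext p; simp [dy]
  rw [spiralDeriv_eq, spiralDeriv_eq, dy_add (isSmooth_x.mul hf.dx) hf.dθ,
    dy_mul isSmooth_x hf.dx, h, dy_dx hf, dy_dθ hf]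
  ring

theorem bracket_add_left {f₁ f₂ : M → ℝ} (h₁ : IsSmooth f₁) (h₂ : IsSmooth f₂) :
    bracket (f₁ + f₂) g = bracket f₁ g + bracket f₂ g := by
  funext p
  simp only [bracket, spiralDeriv_add h₁ h₂, dy_add h₁ h₂, Pi.add_apply]; ring

theorem bracket_add_right {g₁ g₂ : M → ℝ} (h₁ : IsSmooth g₁) (h₂ : IsSmooth g₂) :
    bracket f (g₁ + g₂) = bracket f g₁ + bracket f g₂ := by
  funext p
  simp only [bracket, spiralDeriv_add h₁ h₂, dy_add h₁ h₂, Pi.add_apply]; ring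

theorem bracket_smul_left (c : ℝ) : bracket (c • f) g = c • bracket f g := by
  funext p
  simp only [bracket, spiralDeriv_smul, dy_smul, Pi.smul_apply, smul_eq_mul]; ring

theorem bracket_smul_right (c : ℝ) : bracket f (c • g) = c • bracket f g := by
  funext p
  simp only [bracket, spiralDeriv_smul, dy_smul, Pi.smul_apply, smul_eq_mul]; ring

theorem dy_bracket (hf : IsSmooth f) (hg : IsSmooth g) :
    dy (bracket f g) = bracket (dy f) g + bracket f (dy g) := by
  rw [bracket_eq, dy_add (hf.spiralDeriv.mul hg.dy) ((hf.dy.mul hg.spiralDeriv).smul _),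
    dy_smul, dy_mul hf.spiralDeriv hg.dy, dy_mul hf.dy hg.spiralDeriv, dy_spiralDeriv hf,
    dy_spiralDeriv hg]
  funext p
  simp [bracket]; ring

theorem dθ_bracket (hf : IsSmooth f) (hg : IsSmooth g) :
    dθ (bracket f g) = bracket (dθ f) g + bracket f (dθ g) := by
  rw [bracket_eq, dθ_add (hf.spiralDeriv.mul hg.dy) ((hf.dy.mul hg.spiralDeriv).smul _),
    dθ_smul, dθ_mul hf.spiralDeriv hg.dy, dθ_mul hf.dy hg.spiralDeriv, dθ_spiralDeriv hf,
    dθ_spiralDeriv hg, ← dy_dθ hf, ← dy_dθ hg]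
  funext p
  simp [bracket]; ring

theorem spiralDeriv_bracket (hf : IsSmooth f) (hg : IsSmooth g) :
    spiralDeriv (bracket f g) = bracket (spiralDeriv f) g + bracket f (spiralDeriv g) := by
  rw [bracket_eq, spiralDeriv_add (hf.spiralDeriv.mul hg.dy)
    ((hf.dy.mul hg.spiralDeriv).smul _), spiralDeriv_smul, spiralDeriv_mul hf.spiralDeriv hg.dy,
    spiralDeriv_mul hf.dy hg.spiralDeriv, ← dy_spiralDeriv hf, ← dy_spiralDeriv hg]
  funext p
  simp [bracket]; ring

/-- The Jacobi identity: `Π` is a Poisson structure. -/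
theorem jacobi {h : M → ℝ} (hf : IsSmooth f) (hg : IsSmooth g) (hh : IsSmooth h) :
    bracket (bracket f g) h = bracket (bracket f h) g + bracket f (bracket g h) := by
  funext p
  have e (a b : M → ℝ) : bracket a b p = spiralDeriv a p * dy b p - dy a p * spiralDeriv b p :=
    rfl
  simp only [Pi.add_apply, e (bracket f g) h, e (bracket f h) g, e f (bracket g h),
    spiralDeriv_bracket hf hg, spiralDeriv_bracket hf hh, spiralDeriv_bracket hg hh,
    dy_bracket hf hg, dy_bracket hf hh, dy_bracket hg hh]
  simp only [bracket, dy_spiralDeriv hf, dy_spiralDeriv hg, dy_spiralDeriv hh]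
  ring

end Rules

/-! Poisson vector fields and the first Poisson cohomology. -/

theorem app_add {f : M → ℝ} (X Y : VF) : (X + Y).app f = X.app f + Y.app f := by
  funext p; simp [VF.app]; ring

theorem app_smul {f : M → ℝ} (c : ℝ) (X : VF) : (c • X).app f = c • X.app f := by
  funext p; simp [VF.app]; ring

theorem ham_app_eq (h : CInf) (f : M → ℝ) : (ham h).app f = bracket f h.1 :=
  funext (ham_app_real h f)

theorem vθ_app (f : M → ℝ) : vθ.app f = dθ f := by funext p; simp [VF.app, vθ, oneC]

theorem vy_app (f : M → ℝ) : vy.app f = dy f := by funext p; simp [VF.app, vy, oneC]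

/-- The Poisson vector fields, that is, the vector fields `X` with `ℒ_X Π = 0`; equivalently,
those which act as derivations of the Poisson bracket. -/
def poissonVF : Submodule ℝ VF where
  carrier := {X | ∀ f g : M → ℝ, IsSmooth f → IsSmooth g →
    X.app (bracket f g) = bracket (X.app f) g + bracket f (X.app g)}
  zero_mem' f g _ _ := by
    have h (k : M → ℝ) : (0 : VF).app k = (0 : ℝ) • (0 : VF).app k := by
      rw [← app_smul, zero_smul]
    rw [h, h f, h g, bracket_smul_left, bracket_smul_right]
    simp
  add_mem' {X Y} hX hY f g hf hg := by
    rw [app_add, app_add, app_add, bracket_add_left (hf.app X) (hf.app Y),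
      bracket_add_right (hg.app X) (hg.app Y), hX f g hf hg, hY f g hf hg]
    ring
  smul_mem' c X hX f g hf hg := by
    rw [app_smul, app_smul, app_smul, bracket_smul_left, bracket_smul_right, hX f g hf hg,
      smul_add]

/-- The Hamiltonian vector fields. -/
noncomputable def hamVF : Submodule ℝ VF where
  carrier := Set.range ham
  zero_mem' := ⟨0, by
    have h1 : dy (0 : M → ℝ) = 0 := by funext p; simp [dy]
    have h2 : dx (0 : M → ℝ) = 0 := by funext p; simp [dx]
    have h3 : dθ (0 : M → ℝ) = 0 := by funext p; simp [dθ]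
    refine Prod.ext ?_ (Prod.ext ?_ ?_) <;> ext p <;>
      simp [ham, spiralDeriv, h1, h2, h3]⟩
  add_mem' := by
    rintro _ _ ⟨h, rfl⟩ ⟨k, rfl⟩
    refine ⟨h + k, ?_⟩
    have h1 : dy (h.1 + k.1) = dy h.1 + dy k.1 := dy_add h.2 k.2
    have h2 : spiralDeriv (h.1 + k.1) = spiralDeriv h.1 + spiralDeriv k.1 :=
      spiralDeriv_add h.2 k.2
    refine Prod.ext ?_ (Prod.ext ?_ ?_) <;> ext p <;> simp [ham, h1, h2] <;> ring
  smul_mem' := by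
    rintro c _ ⟨h, rfl⟩
    refine ⟨c • h, ?_⟩
    have h1 : dy (c • h.1) = c • dy h.1 := dy_smul c
    have h2 : spiralDeriv (c • h.1) = c • spiralDeriv h.1 := spiralDeriv_smul c
    refine Prod.ext ?_ (Prod.ext ?_ ?_) <;> ext p <;> simp [ham, h1, h2]
    ring

theorem hamVF_le_poissonVF : hamVF ≤ poissonVF := by
  intro X hX
  obtain ⟨h, rfl⟩ : ∃ h, ham h = X := hX
  intro f g hf hg
  simp only [ham_app_eq]
  exact jacobi hf hg h.2

theorem vθ_mem : vθ ∈ poissonVF := fun f g hf hg => by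
  simpa only [vθ_app] using dθ_bracket hf hg

theorem vy_mem : vy ∈ poissonVF := fun f g hf hg => by
  simpa only [vy_app] using dy_bracket hf hg

/-- The first Poisson cohomology: Poisson vector fields modulo Hamiltonian vector fields, as a
subspace of the space of all vector fields modulo Hamiltonian ones. -/
noncomputable abbrev H1 : Submodule ℝ (VF ⧸ hamVF) := poissonVF.map hamVF.mkQ

/-- The class `[X] ∈ H1` of a Poisson vector field. -/
noncomputable def cls (X : poissonVF) : H1 := ⟨hamVF.mkQ X.1, Submodule.mem_map_of_mem X.2⟩

/-- Two Poisson vector fields are cohomologous if they differ by a Hamiltonian vector field. -/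
theorem cls_eq_iff (X Y : poissonVF) : cls X = cls Y ↔ ∃ h : CInf, X.1 = Y.1 + ham h := by
  rw [cls, cls, Subtype.mk.injEq, Submodule.mkQ_apply, Submodule.mkQ_apply,
    Submodule.Quotient.eq]
  constructor
  · rintro ⟨h, hh⟩
    exact ⟨h, by rw [hh]; abel⟩
  · rintro ⟨h, hh⟩
    exact ⟨h, by rw [hh]; abel⟩

/-- The Poisson vector field `A ∂_θ + B ∂_y`. -/
def X₀ (A B : ℝ) : poissonVF := A • ⟨vθ, vθ_mem⟩ + B • ⟨vy, vy_mem⟩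

/-! Test functions and KMS functionals. -/

/-- `C_c^∞(M)`, complex-valued. -/
def Test : Submodule ℂ (M → ℂ) where
  carrier := {f | IsSmooth f ∧ HasCompactSupport f}
  zero_mem' := ⟨isSmooth_const 0, HasCompactSupport.zero⟩
  add_mem' hf hg := ⟨hf.1.add hg.1, hf.2.add hg.2⟩
  smul_mem' c _ hf := ⟨(isSmooth_const c).mul hf.1, hf.2.smul_left (f := fun _ => c)⟩

section Support

variable {f : M → ℂ}

theorem comp_support (hf : HasCompactSupport f) {D : (M → ℂ) → M → ℂ}
    (hD : ∀ p, f =ᶠ[nhds p] 0 → D f p = 0) : HasCompactSupport (D f) := by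
  refine HasCompactSupport.intro hf fun p hp => hD p ?_
  exact notMem_tsupport_iff_eventuallyEq.mp hp

theorem hcs_dx (hf : HasCompactSupport f) : HasCompactSupport (dx f) := by
  refine comp_support (D := dx) hf fun p hp => ?_
  have hc : Filter.Tendsto (fun s : ℝ => ((p.1 + s, p.2.1, p.2.2) : M)) (nhds 0) (nhds p) := by
    have : Continuous (fun s : ℝ => ((p.1 + s, p.2.1, p.2.2) : M)) := by fun_prop
    simpa using this.tendsto 0
  have := Filter.EventuallyEq.deriv_eq (𝕜 := ℝ) (hp.comp_tendsto hc)
  simpa [dx, Function.comp_def] using this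

theorem hcs_dθ (hf : HasCompactSupport f) : HasCompactSupport (dθ f) := by
  refine comp_support (D := dθ) hf fun p hp => ?_
  have hc : Filter.Tendsto (fun s : ℝ => ((p.1, p.2.1 + (s : T), p.2.2) : M)) (nhds 0)
      (nhds p) := by
    have hs : Continuous (fun s : ℝ => (s : T)) := AddCircle.continuous_mk' _
    have : Continuous (fun s : ℝ => ((p.1, p.2.1 + (s : T), p.2.2) : M)) := by fun_prop
    simpa using this.tendsto 0
  have := Filter.EventuallyEq.deriv_eq (𝕜 := ℝ) (hp.comp_tendsto hc)
  simpa [dθ, Function.comp_def] using this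

theorem hcs_dy (hf : HasCompactSupport f) : HasCompactSupport (dy f) := by
  refine comp_support (D := dy) hf fun p hp => ?_
  have hc : Filter.Tendsto (fun s : ℝ => ((p.1, p.2.1, p.2.2 + s) : M)) (nhds 0) (nhds p) := by
    have : Continuous (fun s : ℝ => ((p.1, p.2.1, p.2.2 + s) : M)) := by fun_prop
    simpa using this.tendsto 0
  have := Filter.EventuallyEq.deriv_eq (𝕜 := ℝ) (hp.comp_tendsto hc)
  simpa [dy, Function.comp_def] using this

theorem hcs_spiralDeriv (hf : HasCompactSupport f) : HasCompactSupport (spiralDeriv f) :=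
  ((hcs_dx hf).mul_left (f := fun p : M => (p.1 : ℂ))).add (hcs_dθ hf)

end Support

/-- The Poisson bracket on `C_c^∞(M)`. -/
noncomputable def tbracket (f g : Test) : Test :=
  ⟨bracket f.1 g.1, f.2.1.bracket g.2.1,
    ((hcs_dy g.2.2).mul_left (f := spiralDeriv f.1)).sub
      ((hcs_dy f.2.2).mul_right (f' := spiralDeriv g.1))⟩

/-- The test function `g X(f)`. -/
noncomputable def tmulApp (g : Test) (X : VF) (f : Test) : Test :=
  ⟨fun p => g.1 p * X.app f.1 p, g.2.1.mul (f.2.1.app X), g.2.2.mul_right⟩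

/-- `C_c^∞(M) → ℂ`, linear. -/
abbrev Functional : Type := Test →ₗ[ℂ] ℂ

/-- Positivity of a functional: `φ(f) ≥ 0` whenever `f ≥ 0` pointwise (an inequality `0 ≤ z`
between complex numbers says that `z` is real and nonnegative). -/
def Positive (φ : Functional) : Prop := ∀ f : Test, (∀ p, 0 ≤ f.1 p) → 0 ≤ φ f

/-- The convex cone `KMS(X, β)` of positive linear functionals on `C_c^∞(M)` such that
`φ({f, g}) = β φ(g X(f))` for all `f, g ∈ C_c^∞(M)`. -/
def KMS (X : VF) (β : ℝ) : Submodule ℝ≥0 Functional where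
  carrier := {φ | Positive φ ∧ ∀ f g : Test, φ (tbracket f g) = β * φ (tmulApp g X f)}
  zero_mem' := ⟨fun f _ => by simp, fun f g => by simp⟩
  add_mem' hφ hψ := ⟨fun f hf => add_nonneg (hφ.1 f hf) (hψ.1 f hf), fun f g => by
    simp [hφ.2 f g, hψ.2 f g, mul_add]⟩
  smul_mem' c φ hφ := ⟨fun f hf => by
      rw [LinearMap.smul_apply, NNReal.smul_def, Complex.real_smul]
      exact mul_nonneg (by exact_mod_cast c.2) (hφ.1 f hf), fun f g => by
      simp only [LinearMap.smul_apply, hφ.2 f g, NNReal.smul_def, Complex.real_smul]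
      ring⟩

/-- The convex cone `KMS(M, Π)` of positive Poisson traces: `φ({f, g}) = 0` for all `f, g`. -/
def poissonTraces : Submodule ℝ≥0 Functional where
  carrier := {φ | Positive φ ∧ ∀ f g : Test, φ (tbracket f g) = 0}
  zero_mem' := ⟨fun f _ => by simp, fun f g => by simp⟩
  add_mem' hφ hψ := ⟨fun f hf => add_nonneg (hφ.1 f hf) (hψ.1 f hf), fun f g => by
    simp [hφ.2 f g, hψ.2 f g]⟩
  smul_mem' c φ hφ := ⟨fun f hf => by
      rw [LinearMap.smul_apply, NNReal.smul_def, Complex.real_smul]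
      exact mul_nonneg (by exact_mod_cast c.2) (hφ.1 f hf), fun f g => by
      simp [hφ.2 f g]⟩

/-- A nonzero element `φ` of a convex cone is extremal if it spans an extreme ray: whenever
`φ = φ₁ + φ₂` in the cone, both `φ₁` and `φ₂` are nonnegative multiples of `φ`. -/
def IsExtremal (C : Submodule ℝ≥0 Functional) (φ : Functional) : Prop :=
  φ ∈ C ∧ φ ≠ 0 ∧ ∀ φ₁ ∈ C, ∀ φ₂ ∈ C, φ = φ₁ + φ₂ →
    ∃ c₁ c₂ : ℝ≥0, φ₁ = c₁ • φ ∧ φ₂ = c₂ • φ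

/-- The integrand of the leafwise functional `_xφ_θ^β`, at `(u, y) ∈ ℝ²`. -/
noncomputable def leafIntegrand (x : ℝ) (θ : T) (β : ℝ) (f : Test) (q : ℝ × ℝ) : ℂ :=
  f.1 (x * Real.exp q.1, θ + (q.1 : T), q.2) * (Real.exp (β * q.1) : ℂ)

/-- `_xφ_θ^β(f) = ∫_{ℝ²} f(x e^u, θ + u, y) e^{β u} du dy`. -/
noncomputable def leafFun (x : ℝ) (θ : T) (β : ℝ) (f : Test) : ℂ :=
  ∫ q : ℝ × ℝ, leafIntegrand x θ β f q

/-- The convex cone `𝓜₊(𝕋)` of positive (finite) Borel measures on the circle. -/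
abbrev MeasT : Type := FiniteMeasure T

end Spiral

namespace Spiral

/-! ### Calculus on `M` -/

section Calculus

variable {𝕜 : Type*} [RCLike 𝕜] {f g : M → 𝕜}

/-! Write D for x ∂_x + ∂_θ. The fields D and ∂_y commute and are complete, so their flows give an
action `act` of ℝ² on M, whose orbits are the cylinder x = 0 and, on either side of it, a circle's
worth of planes spiralling towards it.

The KMS identity for A ∂_θ + B ∂_y can be tested against the non-compactly supported functions g =
1, y, e^{iθ}, x. This gives φ(Df) = -Bβ φ(f), φ(∂_y f) = Aβ φ(f) and A φ(xf) = 0, and these three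
relations imply the KMS identity in return (`mem_KMS_X₀_iff`). A positive functional is integration
against a Radon measure (`exists_measure`), and the first two relations integrate to the statement
that the measure is scaled by a character of ℝ² under the action (`map_act`).

Which strata may carry mass is then decided by dynamics. The flow of D preserves bounded pieces of x
= 0, so a factor other than 1 forbids mass there (`measure_x_eq_of_ne`). Run backwards, the same
flow sweeps bounded pieces of x ≠ 0 into ever thinner neighbourhoods of x = 0, so the mass must
decay and B ≤ 0 forbids it (`measure_x_ne_of_nonpos`). If A ≠ 0, the relation A φ(xf) = 0 forbids it
too (`measure_x_ne_of_mul`).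

On a surviving stratum the measure is disintegrated along orbits with a weight of orbital integral
one (`lintegral_eq_orbital`). For B = 0 only the cylinder is left; the action is transitive there,
so the measure is unique up to scale. For B > 0 and A = 0 the action is free on x ≠ 0, and the
orbits are labelled by the sign of x and the base point θ - log |x|, which yields two finite
measures on the circle (`exists_eq_leafMeasure`). The extreme rays correspond to Dirac measures.

Other representatives of a cohomology class are reached by multiplying with e^{-βh} (`KMS_add_ham`).
-/

theorem IsSmooth.continuous (hf : IsSmooth f) : Continuous f :=
  continuous_lift_iff.mp (ContDiff.continuous hf)

theorem hasDerivAt_dx (hf : IsSmooth f) (p : M) :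
    HasDerivAt (fun s : ℝ => f (p.1 + s, p.2.1, p.2.2)) (dx f p) 0 := by
  obtain ⟨q, rfl⟩ := exists_lift p
  have h := deriv_line hf q (1, 0, 0)
  rw [← lift_dx hf] at h
  simpa [lift] using h

theorem hasDerivAt_dθ (hf : IsSmooth f) (p : M) :
    HasDerivAt (fun s : ℝ => f (p.1, p.2.1 + (s : T), p.2.2)) (dθ f p) 0 := by
  obtain ⟨q, rfl⟩ := exists_lift p
  have h := deriv_line hf q (0, 1, 0)
  rw [← lift_dθ hf] at h
  simpa [lift] using h

theorem hasDerivAt_dy (hf : IsSmooth f) (p : M) :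
    HasDerivAt (fun s : ℝ => f (p.1, p.2.1, p.2.2 + s)) (dy f p) 0 := by
  obtain ⟨q, rfl⟩ := exists_lift p
  have h := deriv_line hf q (0, 0, 1)
  rw [← lift_dy hf] at h
  simpa [lift] using h

theorem hasDerivAt_dy_line (hf : IsSmooth f) (x : ℝ) (θ : T) (y : ℝ) :
    HasDerivAt (fun s : ℝ => f (x, θ, s)) (dy f (x, θ, y)) y := by
  have h := hasDerivAt_dy hf (x, θ, y)
  rw [show (0 : ℝ) = y - y by ring] at h
  simpa using h.comp_sub_const y y

/-- The curve t ↦ (x e^t, θ + t, y) is an integral curve of D; on the covering this is the chain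
rule. -/
theorem hasDerivAt_spiral (hf : IsSmooth f) (x : ℝ) (θ : T) (y t : ℝ) :
    HasDerivAt (fun t : ℝ => f (x * Real.exp t, θ + (t : T), y))
      (spiralDeriv f (x * Real.exp t, θ + (t : T), y)) t := by
  obtain ⟨s, rfl⟩ := QuotientAddGroup.mk_surjective θ
  have h1 : HasDerivAt (fun t : ℝ => (x * Real.exp t, s + t, y)) (x * Real.exp t, 1, 0) t :=
    ((Real.hasDerivAt_exp t).const_mul x).prodMk
      (((hasDerivAt_id t).const_add s).prodMk (hasDerivAt_const t y))
  have h2 := (hf.hasFDerivAt (x * Real.exp t, s + t, y)).comp_hasDerivAt t h1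
  have e : ((x * Real.exp t, 1, 0) : ℝ × ℝ × ℝ)
      = (x * Real.exp t) • (1, 0, 0) + (0, 1, 0) := by simp
  rw [e, map_add, map_smul, ← lift_dx hf, ← lift_dθ hf] at h2
  rw [RCLike.real_smul_eq_coe_mul] at h2
  exact h2

theorem dx_mul_apply (hf : IsSmooth f) (hg : IsSmooth g) (p : M) :
    dx (f * g) p = dx f p * g p + f p * dx g p := by
  have h := ((hasDerivAt_dx hf p).mul (hasDerivAt_dx hg p)).deriv
  simp only [add_zero] at h
  exact h

theorem dθ_mul_apply (hf : IsSmooth f) (hg : IsSmooth g) (p : M) :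
    dθ (f * g) p = dθ f p * g p + f p * dθ g p := by
  have h := ((hasDerivAt_dθ hf p).mul (hasDerivAt_dθ hg p)).deriv
  simp only [add_zero, AddCircle.coe_zero] at h
  exact h

theorem dy_mul_apply (hf : IsSmooth f) (hg : IsSmooth g) (p : M) :
    dy (f * g) p = dy f p * g p + f p * dy g p := by
  have h := ((hasDerivAt_dy hf p).mul (hasDerivAt_dy hg p)).deriv
  simp only [add_zero] at h
  exact h

theorem spiralDeriv_mul_apply (hf : IsSmooth f) (hg : IsSmooth g) (p : M) :
    spiralDeriv (f * g) p = spiralDeriv f p * g p + f p * spiralDeriv g p := by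
  simp only [spiralDeriv, dx_mul_apply hf hg, dθ_mul_apply hf hg]; ring

theorem dy_add_apply (hf : IsSmooth f) (hg : IsSmooth g) (p : M) :
    dy (f + g) p = dy f p + dy g p := by
  have h := ((hasDerivAt_dy hf p).add (hasDerivAt_dy hg p)).deriv
  exact h

theorem fderiv_lift_symm (hf : IsSmooth f) (v w q : ℝ × ℝ × ℝ) :
    fderiv ℝ (fun r => fderiv ℝ (lift f) r v) q w
      = fderiv ℝ (fun r => fderiv ℝ (lift f) r w) q v := by
  have hd : DifferentiableAt ℝ (fderiv ℝ (lift f)) q :=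
    (ContDiff.fderiv_right hf (m := ∞) (by simp)).differentiable (by simp) q
  have hs : IsSymmSndFDerivAt ℝ (lift f) q :=
    (ContDiff.contDiffAt hf).isSymmSndFDerivAt (by simpa using ENat.LEInfty.out)
  rw [fderiv_clm_apply hd (differentiableAt_const v),
    fderiv_clm_apply hd (differentiableAt_const w)]
  simpa using hs w v

theorem dy_dx_apply (hf : IsSmooth f) (p : M) : dy (dx f) p = dx (dy f) p := by
  obtain ⟨q, rfl⟩ := exists_lift p
  change lift (dy (dx f)) q = lift (dx (dy f)) q
  rw [lift_dy hf.dx, lift_dx hf.dy, funext (lift_dx hf), funext (lift_dy hf), fderiv_lift_symm hf]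

theorem dy_dθ_apply (hf : IsSmooth f) (p : M) : dy (dθ f) p = dθ (dy f) p := by
  obtain ⟨q, rfl⟩ := exists_lift p
  change lift (dy (dθ f)) q = lift (dθ (dy f)) q
  rw [lift_dy hf.dθ, lift_dθ hf.dy, funext (lift_dθ hf), funext (lift_dy hf), fderiv_lift_symm hf]

theorem dy_spiralDeriv_apply (hf : IsSmooth f) (p : M) :
    dy (spiralDeriv f) p = spiralDeriv (dy f) p := by
  have hx : IsSmooth (fun p : M => (p.1 : 𝕜)) := isSmooth_x.ofReal
  have h : dy (fun p : M => (p.1 : 𝕜)) p = 0 := by simp [dy]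
  have e : spiralDeriv f = (fun p : M => (p.1 : 𝕜)) * dx f + dθ f := rfl
  rw [e, dy_add_apply (hx.mul hf.dx) hf.dθ, dy_mul_apply hx hf.dx, h, dy_dx_apply hf,
    dy_dθ_apply hf]
  simp [spiralDeriv]

/-- The cross terms f D∂_y g and f ∂_y Dg cancel because D and ∂_y commute. In this form the bracket
can be evaluated by any functional that is known on derivatives Df and ∂_y f. -/
theorem bracket_eq_divergence (hf : IsSmooth f) (hg : IsSmooth g) (p : M) :
    bracket f g p = spiralDeriv (f * dy g) p - dy (f * spiralDeriv g) p := by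
  rw [spiralDeriv_mul_apply hf hg.dy, dy_mul_apply hf hg.spiralDeriv, dy_spiralDeriv_apply hg,
    bracket]
  ring

theorem bracket_mul_right (hg : IsSmooth g) {k : M → 𝕜} (hk : IsSmooth k) (p : M) :
    bracket f (k * g) p = k p * bracket f g p + g p * bracket f k p := by
  simp only [bracket, spiralDeriv_mul_apply hk hg, dy_mul_apply hk hg]; ring

/-! Derivatives are local. -/

theorem dx_congr {p : M} (h : f =ᶠ[nhds p] g) : dx f p = dx g p := by
  have hc : Filter.Tendsto (fun s : ℝ => ((p.1 + s, p.2.1, p.2.2) : M)) (nhds 0) (nhds p) := by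
    have : Continuous (fun s : ℝ => ((p.1 + s, p.2.1, p.2.2) : M)) := by fun_prop
    simpa using this.tendsto 0
  exact Filter.EventuallyEq.deriv_eq (𝕜 := ℝ) (h.comp_tendsto hc)

theorem dθ_congr {p : M} (h : f =ᶠ[nhds p] g) : dθ f p = dθ g p := by
  have hc : Filter.Tendsto (fun s : ℝ => ((p.1, p.2.1 + (s : T), p.2.2) : M)) (nhds 0)
      (nhds p) := by
    have hs : Continuous (fun s : ℝ => (s : T)) := AddCircle.continuous_mk' _
    have : Continuous (fun s : ℝ => ((p.1, p.2.1 + (s : T), p.2.2) : M)) := by fun_prop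
    simpa using this.tendsto 0
  exact Filter.EventuallyEq.deriv_eq (𝕜 := ℝ) (h.comp_tendsto hc)

theorem dy_congr {p : M} (h : f =ᶠ[nhds p] g) : dy f p = dy g p := by
  have hc : Filter.Tendsto (fun s : ℝ => ((p.1, p.2.1, p.2.2 + s) : M)) (nhds 0) (nhds p) := by
    have : Continuous (fun s : ℝ => ((p.1, p.2.1, p.2.2 + s) : M)) := by fun_prop
    simpa using this.tendsto 0
  exact Filter.EventuallyEq.deriv_eq (𝕜 := ℝ) (h.comp_tendsto hc)

theorem spiralDeriv_congr {p : M} (h : f =ᶠ[nhds p] g) : spiralDeriv f p = spiralDeriv g p := by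
  rw [spiralDeriv, spiralDeriv, dx_congr h, dθ_congr h]

/-! Particular functions. -/

@[simp] theorem dx_const (c : 𝕜) (p : M) : dx (fun _ => c) p = 0 := by simp [dx]
@[simp] theorem dθ_const (c : 𝕜) (p : M) : dθ (fun _ => c) p = 0 := by simp [dθ]
@[simp] theorem dy_const (c : 𝕜) (p : M) : dy (fun _ => c) p = 0 := by simp [dy]
@[simp] theorem spiralDeriv_const (c : 𝕜) (p : M) : spiralDeriv (fun _ => c) p = 0 := by
  simp [spiralDeriv]

theorem dy_ofReal {h : M → ℝ} (hh : IsSmooth h) (p : M) :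
    dy (fun p => (h p : 𝕜)) p = ((dy h p : ℝ) : 𝕜) :=
  ((RCLike.ofRealCLM (K := 𝕜)).hasFDerivAt.comp_hasDerivAt 0 (hasDerivAt_dy hh p)).deriv

theorem dx_ofReal {h : M → ℝ} (hh : IsSmooth h) (p : M) :
    dx (fun p => (h p : 𝕜)) p = ((dx h p : ℝ) : 𝕜) :=
  ((RCLike.ofRealCLM (K := 𝕜)).hasFDerivAt.comp_hasDerivAt 0 (hasDerivAt_dx hh p)).deriv

theorem dθ_ofReal {h : M → ℝ} (hh : IsSmooth h) (p : M) :
    dθ (fun p => (h p : 𝕜)) p = ((dθ h p : ℝ) : 𝕜) :=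
  ((RCLike.ofRealCLM (K := 𝕜)).hasFDerivAt.comp_hasDerivAt 0 (hasDerivAt_dθ hh p)).deriv

theorem spiralDeriv_ofReal {h : M → ℝ} (hh : IsSmooth h) (p : M) :
    spiralDeriv (fun p => (h p : 𝕜)) p = ((spiralDeriv h p : ℝ) : 𝕜) := by
  simp [spiralDeriv, dx_ofReal hh, dθ_ofReal hh]

end Calculus

theorem fact_two_pi_pos : Fact (0 < 2 * Real.pi) := ⟨Real.two_pi_pos⟩

theorem continuous_coe_T : Continuous (fun s : ℝ => (s : T)) := AddCircle.continuous_mk' _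

/-! ### Cutoff functions -/

/-- The embedding of `M` into a vector space given by `𝕋 ≃ S¹ ⊆ ℂ`. -/
noncomputable def embed (p : M) : ℝ × ℂ × ℝ := (p.1, (AddCircle.homeomorphCircle' p.2.1 : ℂ), p.2.2)

theorem isClosedEmbedding_embed : Topology.IsClosedEmbedding embed := by
  have := fact_two_pi_pos
  have h : Topology.IsClosedEmbedding (fun θ : T => (AddCircle.homeomorphCircle' θ : ℂ)) :=
    (continuous_subtype_val.comp AddCircle.homeomorphCircle'.continuous).isClosedEmbedding
      (Subtype.val_injective.comp AddCircle.homeomorphCircle'.injective)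
  exact Topology.IsClosedEmbedding.prodMap .id (Topology.IsClosedEmbedding.prodMap h .id)

theorem isSmooth_comp_embed {F : ℝ × ℂ × ℝ → ℝ} (hF : ContDiff ℝ ∞ F) :
    IsSmooth (F ∘ embed) := by
  have e : lift (F ∘ embed) = F ∘ fun q : ℝ × ℝ × ℝ =>
      (q.1, Complex.exp (q.2.1 * Complex.I), q.2.2) := by
    funext q
    have : (AddCircle.homeomorphCircle' (q.2.1 : T) : ℂ) = Complex.exp (q.2.1 * Complex.I) := by
      rw [AddCircle.homeomorphCircle'_apply_mk, Circle.coe_exp]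
    simp only [lift, embed, Function.comp_apply, this]
  have h : ContDiff ℝ ∞ fun q : ℝ × ℝ × ℝ => Complex.exp (q.2.1 * Complex.I) := by
    refine ContDiff.cexp (ContDiff.mul ?_ contDiff_const)
    exact Complex.ofRealCLM.contDiff.comp (contDiff_fst.comp contDiff_snd)
  unfold IsSmooth
  rw [e]
  exact hF.comp (contDiff_fst.prodMk (h.prodMk (contDiff_snd.comp contDiff_snd)))

/-- A smooth Urysohn function on the vector space ℝ × ℂ × ℝ is restricted along the closed embedding
of M. Having χ = 1 on a neighbourhood of K, and not only on K, makes multiplication by χ harmless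
for derivatives at points of K. -/
theorem exists_cutoff {K U : Set M} (hK : IsCompact K) (hU : IsOpen U) (hKU : K ⊆ U) :
    ∃ χ : M → ℝ, IsSmooth χ ∧ HasCompactSupport χ ∧ (∀ᶠ p in nhdsSet K, χ p = 1) ∧
      (∀ p ∉ U, χ p = 0) ∧ ∀ p, χ p ∈ Set.Icc (0 : ℝ) 1 := by
  obtain ⟨L, hL, hKL, hLU⟩ := exists_compact_between hK hU hKU
  have hd : Disjoint (embed '' (interior L)ᶜ) (embed '' K) := by
    rw [Set.disjoint_image_iff isClosedEmbedding_embed.injective]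
    exact Set.disjoint_compl_left_iff_subset.mpr hKL
  obtain ⟨F, h0, h1, hF⟩ := exists_contMDiffMap_zero_one_nhds_of_isClosed
    (modelWithCornersSelf ℝ (ℝ × ℂ × ℝ)) (n := ⊤)
    (isClosedEmbedding_embed.isClosedMap _ isOpen_interior.isClosed_compl)
    (isClosedEmbedding_embed.isClosedMap _ hK.isClosed) hd
  have hz : ∀ p ∉ L, F (embed p) = 0 := fun p hp =>
    h0.self_of_nhdsSet _ ⟨p, fun h => hp (interior_subset h), rfl⟩
  refine ⟨F ∘ embed, isSmooth_comp_embed F.contMDiff.contDiff, HasCompactSupport.intro hL hz,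
    ?_, fun p hp => hz p fun h => hp (hLU h), fun p => hF _⟩
  have ht : Filter.Tendsto embed (nhdsSet K) (nhdsSet (embed '' K)) :=
    isClosedEmbedding_embed.continuous.tendsto_nhdsSet (Set.mapsTo_image _ _)
  exact ht.eventually h1

/-! ### Operations on test functions -/

/-- The product of a smooth function and a test function. -/
def tmul (g : M → ℂ) (hg : IsSmooth g) : Test →ₗ[ℂ] Test where
  toFun f := ⟨g * f.1, hg.mul f.2.1, f.2.2.mul_left⟩
  map_add' f k := Subtype.ext (mul_add g f.1 k.1)
  map_smul' c f := Subtype.ext (mul_smul_comm c g f.1)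

/-- `D f` for `D = x ∂_x + ∂_θ`. -/
noncomputable def tspiral (f : Test) : Test :=
  ⟨spiralDeriv f.1, f.2.1.spiralDeriv, hcs_spiralDeriv f.2.2⟩

/-- `∂f/∂y`. -/
noncomputable def tdy (f : Test) : Test := ⟨dy f.1, f.2.1.dy, hcs_dy f.2.2⟩

/-- `{f, g}` for a test function `f` and a smooth function `g`. -/
noncomputable def tbracketSmooth (f : Test) (g : M → ℂ) (hg : IsSmooth g) : Test :=
  ⟨bracket f.1 g, f.2.1.bracket hg,
    ((hcs_spiralDeriv f.2.2).mul_right).sub ((hcs_dy f.2.2).mul_right)⟩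

theorem hcs_app {f : M → ℂ} (hf : HasCompactSupport f) (X : VF) : HasCompactSupport (X.app f) :=
  (((hcs_dx hf).mul_left).add ((hcs_dθ hf).mul_left)).add ((hcs_dy hf).mul_left)

/-- `X(f)` for a vector field `X`. -/
noncomputable def tapp (X : VF) (f : Test) : Test :=
  ⟨X.app f.1, f.2.1.app X, hcs_app f.2.2 X⟩

theorem app_congr {X : VF} {f g : M → ℂ} {p : M} (h : f =ᶠ[nhds p] g) :
    X.app f p = X.app g p := by
  rw [VF.app, VF.app, dx_congr h, dθ_congr h, dy_congr h]

theorem app_zero (X : VF) (p : M) : X.app (0 : M → ℂ) p = 0 := by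
  have e : (0 : M → ℂ) = fun _ => 0 := rfl
  rw [e, VF.app]
  simp

/-- Both sides see g only near the support of f, so g may be cut off there. This admits the test
functions 1, x, y and e^{iθ}. -/
theorem KMS_smooth {X : VF} {β : ℝ} {φ : Functional} (hφ : φ ∈ KMS X β) (f : Test) {g : M → ℂ}
    (hg : IsSmooth g) : φ (tbracketSmooth f g hg) = β * φ (tmul g hg (tapp X f)) := by
  obtain ⟨χ, hχ, hc, h1, -, -⟩ := exists_cutoff f.2.2 isOpen_univ (Set.subset_univ _)
  have hc' : HasCompactSupport (fun p => (χ p : ℂ)) := hc.comp_left (g := ((↑) : ℝ → ℂ)) (by simp)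
  let k : Test := ⟨(fun p => (χ p : ℂ)) * g, hχ.ofReal.mul hg, hc'.mul_right⟩
  have hk : ∀ p ∈ tsupport f.1, k.1 =ᶠ[nhds p] g := fun p hp => by
    filter_upwards [Filter.Eventually.filter_mono (nhds_le_nhdsSet hp) h1] with q hq
    simp [k, hq]
  have h0 : ∀ p ∉ tsupport f.1, f.1 =ᶠ[nhds p] fun _ => 0 := fun p hp =>
    notMem_tsupport_iff_eventuallyEq.mp hp
  have e1 : tbracketSmooth f g hg = tbracket f k := by
    refine Subtype.ext (funext fun p => ?_)
    change bracket f.1 g p = bracket f.1 k.1 p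
    by_cases hp : p ∈ tsupport f.1
    · rw [bracket, bracket, spiralDeriv_congr (hk p hp), dy_congr (hk p hp)]
    · simp [bracket, spiralDeriv_congr (h0 p hp), dy_congr (h0 p hp)]
  have e2 : tmul g hg (tapp X f) = tmulApp k X f := by
    refine Subtype.ext (funext fun p => ?_)
    change g p * X.app f.1 p = k.1 p * X.app f.1 p
    by_cases hp : p ∈ tsupport f.1
    · rw [(hk p hp).eq_of_nhds]
    · rw [app_congr (h0 p hp)]
      have := app_zero X p
      simp only [Pi.zero_def] at this
      simp [this]
  rw [e1, e2]
  exact hφ.2 f k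

theorem X₀_app (A B : ℝ) (f : M → ℂ) (p : M) :
    VF.app (X₀ A B) f p = A * dθ f p + B * dy f p := by
  simp [VF.app, X₀, vθ, vy, oneC]

/-! The functions `x`, `y` and `e^{iθ}`. -/

theorem isSmooth_xC : IsSmooth (fun p : M => (p.1 : ℂ)) := isSmooth_x.ofReal

theorem isSmooth_y : IsSmooth (fun p : M => p.2.2) :=
  ContDiff.comp (g := Prod.snd (α := ℝ) (β := ℝ)) contDiff_snd contDiff_snd

theorem isSmooth_yC : IsSmooth (fun p : M => (p.2.2 : ℂ)) := isSmooth_y.ofReal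

/-- The function `e^{iθ}` on `M`. -/
noncomputable def expθ (p : M) : ℂ := AddCircle.homeomorphCircle' p.2.1

theorem lift_expθ (q : ℝ × ℝ × ℝ) : lift expθ q = Complex.exp (q.2.1 * Complex.I) := by
  rw [lift, expθ, AddCircle.homeomorphCircle'_apply_mk, Circle.coe_exp]

theorem isSmooth_expθ : IsSmooth expθ := by
  unfold IsSmooth
  rw [funext lift_expθ]
  refine ContDiff.cexp (ContDiff.mul ?_ contDiff_const)
  exact Complex.ofRealCLM.contDiff.comp (contDiff_fst.comp contDiff_snd)

theorem isSmooth_conj {f : M → ℂ} (hf : IsSmooth f) :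
    IsSmooth (fun p => (starRingEnd ℂ) (f p)) :=
  (Complex.conjCLE.toContinuousLinearMap).contDiff.comp hf

theorem expθ_mul_conj (p : M) : expθ p * (starRingEnd ℂ) (expθ p) = 1 := by
  rw [Complex.mul_conj, Complex.normSq_eq_norm_sq, expθ, Circle.norm_coe]
  simp

theorem dθ_expθ (p : M) : dθ expθ p = Complex.I * expθ p := by
  obtain ⟨q, rfl⟩ := exists_lift p
  have h : HasDerivAt (fun s : ℝ => Complex.exp (((q.2.1 + s : ℝ) : ℂ) * Complex.I))
      (Complex.exp (((q.2.1 + 0 : ℝ) : ℂ) * Complex.I) * (1 * Complex.I)) 0 :=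
    (((hasDerivAt_id (0 : ℝ)).const_add q.2.1).ofReal_comp.mul_const Complex.I).cexp
  have e : (fun s : ℝ => expθ (q.1, (q.2.1 : T) + (s : T), q.2.2))
      = fun s : ℝ => Complex.exp (((q.2.1 + s : ℝ) : ℂ) * Complex.I) :=
    funext fun s => lift_expθ (q.1, q.2.1 + s, q.2.2)
  rw [dθ, e, h.deriv, show expθ (q.1, (q.2.1 : T), q.2.2) = _ from lift_expθ q]
  simp [mul_comm]

theorem dx_expθ (p : M) : dx expθ p = 0 := by simp [dx, expθ]

theorem dy_expθ (p : M) : dy expθ p = 0 := by simp [dy, expθ]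

theorem dy_y (p : M) : dy (fun p : M => (p.2.2 : ℂ)) p = 1 := by
  rw [show (fun p : M => (p.2.2 : ℂ)) = fun p => (((fun p : M => p.2.2) p : ℝ) : ℂ) from rfl]
  have := dy_ofReal (𝕜 := ℂ) isSmooth_y p
  simp only [RCLike.ofReal_eq_complex_ofReal] at this
  rw [this]
  simp [dy]

theorem dθ_y (p : M) : dθ (fun p : M => (p.2.2 : ℂ)) p = 0 := by simp [dθ]

theorem dx_y (p : M) : dx (fun p : M => (p.2.2 : ℂ)) p = 0 := by simp [dx]

theorem dθ_x (p : M) : dθ (fun p : M => (p.1 : ℂ)) p = 0 := by simp [dθ]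

theorem dy_x (p : M) : dy (fun p : M => (p.1 : ℂ)) p = 0 := by simp [dy]

theorem dx_x (p : M) : dx (fun p : M => (p.1 : ℂ)) p = 1 := by
  have := dx_ofReal (𝕜 := ℂ) isSmooth_x p
  simp only [RCLike.ofReal_eq_complex_ofReal] at this
  rw [this]
  simp [dx]

theorem spiralDeriv_x (p : M) : spiralDeriv (fun p : M => (p.1 : ℂ)) p = p.1 := by
  simp [spiralDeriv, dx_x, dθ_x]

/-! ### An infinitesimal characterisation of the KMS functionals of `A ∂_θ + B ∂_y` -/

/-- `φ` transforms under the flows of `x ∂_x + ∂_θ` and `∂_y` with the exponents `-γ` and `κ`. -/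
def IsQuasiInvariant (γ κ : ℝ) (φ : Functional) : Prop :=
  (∀ f, φ (tspiral f) = -γ * φ f) ∧ ∀ f, φ (tdy f) = κ * φ f

/-- Multiplication of test functions by the coordinate `x`. -/
noncomputable abbrev tmulX : Test →ₗ[ℂ] Test := tmul (fun p : M => (p.1 : ℂ)) isSmooth_xC

/-- The choice g = 1 kills the bracket, and β ≠ 0. -/
theorem KMS_app {X : VF} {β : ℝ} (hβ : 0 < β) {φ : Functional} (hφ : φ ∈ KMS X β) (f : Test) :
    φ (tapp X f) = 0 := by
  have h := KMS_smooth hφ f (isSmooth_const 1)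
  have e1 : tbracketSmooth f (fun _ => 1) (isSmooth_const 1) = 0 := by
    refine Subtype.ext (funext fun p => ?_)
    change bracket f.1 (fun _ => 1) p = 0
    simp [bracket]
  have e2 : tmul (fun _ => 1) (isSmooth_const 1) (tapp X f) = tapp X f :=
    Subtype.ext (one_mul (tapp X f).1)
  rw [e1, e2, map_zero, eq_comm, mul_eq_zero] at h
  exact h.resolve_left (by exact_mod_cast hβ.ne')

/-- The choice g = y: the bracket {f, y} is Df, while X(yf) = y X(f) + B f is annihilated by φ, so
that φ(y X(f)) = -B φ(f). -/
theorem KMS_X₀_spiral {A B β : ℝ} (hβ : 0 < β) {φ : Functional} (hφ : φ ∈ KMS (X₀ A B) β)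
    (f : Test) : φ (tspiral f) = -(B * β : ℝ) * φ f := by
  have h := KMS_smooth hφ f isSmooth_yC
  have e1 : tbracketSmooth f _ isSmooth_yC = tspiral f := by
    refine Subtype.ext (funext fun p => ?_)
    change bracket f.1 _ p = spiralDeriv f.1 p
    simp [bracket, spiralDeriv, dy_y, dx_y, dθ_y]
  have e2 : tapp (X₀ A B) (tmul _ isSmooth_yC f)
      = tmul _ isSmooth_yC (tapp (X₀ A B) f) + (B : ℂ) • f := by
    refine Subtype.ext (funext fun p => ?_)
    change VF.app (X₀ A B) ((fun p : M => (p.2.2 : ℂ)) * f.1) p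
      = p.2.2 * VF.app (X₀ A B) f.1 p + B * f.1 p
    rw [X₀_app, X₀_app, dθ_mul_apply isSmooth_yC f.2.1, dy_mul_apply isSmooth_yC f.2.1, dθ_y, dy_y]
    ring
  have h0 := KMS_app hβ hφ (tmul _ isSmooth_yC f)
  rw [e2, map_add, map_smul, smul_eq_mul] at h0
  rw [← e1, h, eq_neg_of_add_eq_zero_left h0]
  push_cast
  ring

/-- One would like to take g = θ, which is not a function on M. Its substitute is g = e^{iθ}, paired
with k = e^{-iθ} f so that the exponentials cancel. -/
theorem KMS_X₀_dy {A B β : ℝ} (hβ : 0 < β) {φ : Functional} (hφ : φ ∈ KMS (X₀ A B) β)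
    (f : Test) : φ (tdy f) = (A * β : ℝ) * φ f := by
  let k : Test := tmul _ (isSmooth_conj isSmooth_expθ) f
  have hk : expθ * k.1 = f.1 := by
    funext p
    change expθ p * ((starRingEnd ℂ) (expθ p) * f.1 p) = f.1 p
    rw [← mul_assoc, expθ_mul_conj, one_mul]
  have h := KMS_smooth hφ k isSmooth_expθ
  have e1 : tbracketSmooth k _ isSmooth_expθ = (-Complex.I) • tdy f := by
    refine Subtype.ext (funext fun p => ?_)
    change bracket k.1 expθ p = -Complex.I * dy f.1 p
    rw [← hk, dy_mul_apply isSmooth_expθ k.2.1]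
    simp [bracket, spiralDeriv, dθ_expθ, dx_expθ, dy_expθ]
    ring
  have e2 : tapp (X₀ A B) f
      = tmul _ isSmooth_expθ (tapp (X₀ A B) k) + (A * Complex.I : ℂ) • f := by
    refine Subtype.ext (funext fun p => ?_)
    change VF.app (X₀ A B) f.1 p = expθ p * VF.app (X₀ A B) k.1 p + (A * Complex.I) * f.1 p
    rw [← hk, X₀_app, X₀_app, dθ_mul_apply isSmooth_expθ k.2.1, dy_mul_apply isSmooth_expθ k.2.1,
      dθ_expθ, dy_expθ, Pi.mul_apply]
    ring
  have h0 := KMS_app hβ hφ f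
  rw [e2, map_add, map_smul, smul_eq_mul] at h0
  rw [e1, map_smul, smul_eq_mul, eq_neg_of_add_eq_zero_left h0] at h
  have h2 : Complex.I * φ (tdy f) = Complex.I * ((A * β : ℝ) * φ f) := by
    push_cast
    linear_combination -h
  exact mul_left_cancel₀ Complex.I_ne_zero h2

/-- The choice g = x: the bracket {f, x} is -∂_y(xf), on which φ is known. The right side vanishes,
because multiplication by x commutes with X and φ annihilates X(xf). -/
theorem KMS_X₀_x {A B β : ℝ} (hβ : 0 < β) {φ : Functional} (hφ : φ ∈ KMS (X₀ A B) β)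
    (f : Test) : A * φ (tmulX f) = 0 := by
  have h := KMS_smooth hφ f isSmooth_xC
  have e1 : tbracketSmooth f _ isSmooth_xC = -tdy (tmulX f) := by
    refine Subtype.ext (funext fun p => ?_)
    change bracket f.1 _ p = -dy ((fun p : M => (p.1 : ℂ)) * f.1) p
    rw [bracket, dy_mul_apply isSmooth_xC f.2.1, dy_x, spiralDeriv_x]
    ring
  have e2 : tmulX (tapp (X₀ A B) f) = tapp (X₀ A B) (tmulX f) := by
    refine Subtype.ext (funext fun p => ?_)
    change p.1 * VF.app (X₀ A B) f.1 p = VF.app (X₀ A B) ((fun p : M => (p.1 : ℂ)) * f.1) p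
    rw [X₀_app, X₀_app, dθ_mul_apply isSmooth_xC f.2.1, dy_mul_apply isSmooth_xC f.2.1, dθ_x, dy_x]
    ring
  rw [e1, e2, KMS_app hβ hφ, map_neg, KMS_X₀_dy hβ hφ] at h
  have hβ' : (β : ℂ) ≠ 0 := by exact_mod_cast hβ.ne'
  refine mul_left_cancel₀ hβ' ?_
  push_cast at h
  linear_combination -h

/-- For the converse, {f, g} is a divergence, and the Leibniz rule turns g X(f) into A (D(fg) - f Dg
- x g f_x) + B (∂_y(fg) - f ∂_y g). The contributions of φ(fg) cancel, since the exponents -Bβ and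
Aβ enter with the coefficients A and B; the term with x is removed by the third condition. -/
theorem mem_KMS_X₀_iff {A B β : ℝ} (hβ : 0 < β) (φ : Functional) :
    φ ∈ KMS (X₀ A B) β ↔ Positive φ ∧ IsQuasiInvariant (B * β) (A * β) φ ∧
      ∀ f, A * φ (tmulX f) = 0 := by
  refine ⟨fun h => ⟨h.1, ⟨KMS_X₀_spiral hβ h, KMS_X₀_dy hβ h⟩, KMS_X₀_x hβ h⟩, ?_⟩
  rintro ⟨h0, ⟨h1, h2⟩, h3⟩
  refine ⟨h0, fun f g => ?_⟩
  let a : Test := tmul _ f.2.1 (tdy g)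
  let b : Test := tmul _ f.2.1 (tspiral g)
  let c : Test := tmul _ f.2.1 g
  let d : Test := tmul _ g.2.1 ⟨dx f.1, f.2.1.dx, hcs_dx f.2.2⟩
  have e1 : tbracket f g = tspiral a - tdy b :=
    Subtype.ext (funext fun p => bracket_eq_divergence f.2.1 g.2.1 p)
  have e2 : tmulApp g (X₀ A B) f
      = (A : ℂ) • (tspiral c - b - tmulX d) + (B : ℂ) • (tdy c - a) := by
    refine Subtype.ext (funext fun p => ?_)
    change g.1 p * VF.app (X₀ A B) f.1 p
      = A * (spiralDeriv (f.1 * g.1) p - f.1 p * spiralDeriv g.1 p - p.1 * (g.1 p * dx f.1 p))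
        + B * (dy (f.1 * g.1) p - f.1 p * dy g.1 p)
    rw [X₀_app, spiralDeriv_mul_apply f.2.1 g.2.1, dy_mul_apply f.2.1 g.2.1, spiralDeriv]
    simp only [Complex.coe_algebraMap]
    ring
  rw [e1, e2]
  simp only [map_add, map_sub, map_smul, smul_eq_mul, h1, h2]
  push_cast
  linear_combination (β : ℂ) * h3 d

/-- Traces are the KMS functionals of the zero vector field, at any β. -/
theorem poissonTraces_eq (β : ℝ) : poissonTraces = KMS (X₀ 0 0) β := by
  have h (f g : Test) : tmulApp g (X₀ 0 0) f = 0 :=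
    Subtype.ext (funext fun p => by
      change g.1 p * VF.app (X₀ 0 0) f.1 p = 0
      simp [X₀_app])
  ext φ
  change (_ ∧ _) ↔ (_ ∧ _)
  simp [h]

/-! ### Cohomologous vector fields -/

/-- The function `e^{s h}`. -/
noncomputable def expMul (s : ℝ) (h : CInf) (p : M) : ℝ := Real.exp (s * h.1 p)

theorem isSmooth_expMul (s : ℝ) (h : CInf) : IsSmooth (expMul s h) :=
  Real.contDiff_exp.comp ((isSmooth_const s).mul h.2)

theorem isSmooth_expMulC (s : ℝ) (h : CInf) : IsSmooth (fun p => (expMul s h p : ℂ)) :=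
  (isSmooth_expMul s h).ofReal

/-- The chain rule for e^{sh}, with the derivation property of the bracket in its second argument.
-/
theorem bracket_expMul (s : ℝ) (h : CInf) (f : M → ℂ) (p : M) :
    bracket f (fun p => (expMul s h p : ℂ)) p = s * expMul s h p * (ham h).app f p := by
  have hx : dx (expMul s h) p = s * expMul s h p * dx h.1 p := by
    have := ((hasDerivAt_dx h.2 p).const_mul s).exp.deriv
    simp only [add_zero] at this
    refine Eq.trans this ?_
    rw [expMul]; ring
  have hθ : dθ (expMul s h) p = s * expMul s h p * dθ h.1 p := by
    have := ((hasDerivAt_dθ h.2 p).const_mul s).exp.deriv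
    simp only [add_zero, AddCircle.coe_zero] at this
    refine Eq.trans this ?_
    rw [expMul]; ring
  have hy : dy (expMul s h) p = s * expMul s h p * dy h.1 p := by
    have := ((hasDerivAt_dy h.2 p).const_mul s).exp.deriv
    simp only [add_zero] at this
    refine Eq.trans this ?_
    rw [expMul]; ring
  have e1 := dy_ofReal (𝕜 := ℂ) (isSmooth_expMul s h) p
  have e2 := spiralDeriv_ofReal (𝕜 := ℂ) (isSmooth_expMul s h) p
  simp only [RCLike.ofReal_eq_complex_ofReal] at e1 e2
  rw [ham_app, bracket, e1, e2]
  simp only [spiralDeriv, hx, hθ, hy]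
  push_cast
  simp only [RCLike.ofReal_eq_complex_ofReal]
  ring

/-- Multiplication of test functions by `e^{s h}`. -/
noncomputable abbrev tmulExp (s : ℝ) (h : CInf) : Test →ₗ[ℂ] Test :=
  tmul (fun p => (expMul s h p : ℂ)) (isSmooth_expMulC s h)

theorem tmulExp_neg (s : ℝ) (h : CInf) (f : Test) : tmulExp s h (tmulExp (-s) h f) = f := by
  refine Subtype.ext (funext fun p => ?_)
  change (expMul s h p : ℂ) * ((expMul (-s) h p : ℂ) * f.1 p) = f.1 p
  rw [← mul_assoc, ← Complex.ofReal_mul, expMul, expMul, ← Real.exp_add]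
  simp

/-- Replacing g by e^{-βh} g in the bracket creates the extra term {f, e^{-βh}} g = -β e^{-βh} g
X_h(f), which is what passing from X to X + X_h demands. -/
theorem KMS_add_ham {X : VF} {β : ℝ} (h : CInf) {φ : Functional} (hφ : φ ∈ KMS X β) :
    φ ∘ₗ tmulExp (-β) h ∈ KMS (X + ham h) β := by
  refine ⟨fun f hf => hφ.1 _ fun p => ?_, fun f g => ?_⟩
  · exact mul_nonneg (Complex.zero_le_real.mpr (Real.exp_pos _).le) (hf p)
  · have e1 : tmulExp (-β) h (tbracket f g)
        = tbracket f (tmulExp (-β) h g) + (β : ℂ) • tmulExp (-β) h (tmulApp g (ham h) f) := by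
      refine Subtype.ext (funext fun p => ?_)
      change (expMul (-β) h p : ℂ) * bracket f.1 g.1 p
        = bracket f.1 ((fun p => (expMul (-β) h p : ℂ)) * g.1) p
          + β * (expMul (-β) h p * (g.1 p * (ham h).app f.1 p))
      rw [bracket_mul_right g.2.1 (isSmooth_expMulC (-β) h), bracket_expMul]
      push_cast
      ring
    have e2 : tmulExp (-β) h (tmulApp g (X + ham h) f)
        = tmulApp (tmulExp (-β) h g) X f + tmulExp (-β) h (tmulApp g (ham h) f) := by
      refine Subtype.ext (funext fun p => ?_)
      change (expMul (-β) h p : ℂ) * (g.1 p * VF.app (X + ham h) f.1 p)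
        = expMul (-β) h p * g.1 p * X.app f.1 p
          + expMul (-β) h p * (g.1 p * (ham h).app f.1 p)
      have : VF.app (X + ham h) f.1 p = X.app f.1 p + (ham h).app f.1 p := by
        simp [VF.app]; ring
      rw [this]
      ring
    simp only [LinearMap.comp_apply, e1, e2, map_add, map_smul, hφ.2, smul_eq_mul]
    ring

theorem ham_neg (h : CInf) : ham (-h) = -ham h := by
  have h1 : dy (-h.1) = -dy h.1 := by funext p; simp [dy]
  have h2 : dx (-h.1) = -dx h.1 := by funext p; simp [dx]
  have h3 : dθ (-h.1) = -dθ h.1 := by funext p; simp [dθ]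
  refine Prod.ext ?_ (Prod.ext ?_ ?_) <;> ext p <;> simp [ham, spiralDeriv, h1, h2, h3]
  ring

/-- Cohomologous vector fields have isomorphic cones of KMS functionals. -/
noncomputable def KMSEquiv (X : VF) (β : ℝ) (h : CInf) : KMS X β ≃ₗ[ℝ≥0] KMS (X + ham h) β where
  toFun φ := ⟨φ.1 ∘ₗ tmulExp (-β) h, KMS_add_ham h φ.2⟩
  map_add' φ ψ := rfl
  map_smul' c φ := rfl
  invFun φ := ⟨φ.1 ∘ₗ tmulExp β h, by
    -- The inverse is the same construction for -h, whose multiplier is e^{βh}.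
    have := KMS_add_ham (-h) φ.2
    rw [ham_neg, add_neg_cancel_right] at this
    rwa [show tmulExp (-β) (-h) = tmulExp β h by
      refine LinearMap.ext fun f => Subtype.ext (funext fun p => ?_)
      change (expMul (-β) (-h) p : ℂ) * f.1 p = expMul β h p * f.1 p
      rw [expMul, expMul, show (-h).1 p = -h.1 p from rfl, neg_mul_neg]] at this⟩
  left_inv φ := Subtype.ext (LinearMap.ext fun f => by
    have := tmulExp_neg (-β) h f
    rw [neg_neg] at this
    exact congrArg φ.1 this)
  right_inv φ := Subtype.ext (LinearMap.ext fun f => congrArg φ.1 (tmulExp_neg β h f))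

/-! ### Positive functionals and measures -/

open scoped CompactlySupported ENNReal

/-- A real test function, as a complex one. -/
def realTest (k : M → ℝ) (hk : IsSmooth k) (hc : HasCompactSupport k) : Test :=
  ⟨fun p => (k p : ℂ), hk.ofReal, hc.comp_left (g := ((↑) : ℝ → ℂ)) (by simp)⟩

theorem integrable_test (μ : Measure M) [IsFiniteMeasureOnCompacts μ] (f : Test) :
    Integrable f.1 μ :=
  f.2.1.continuous.integrable_of_hasCompactSupport f.2.2

/-- Integration with respect to a locally finite measure. -/
noncomputable def ofMeasure (μ : Measure M) [IsFiniteMeasureOnCompacts μ] : Functional where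
  toFun f := ∫ p, f.1 p ∂μ
  map_add' f g := integral_add (integrable_test μ f) (integrable_test μ g)
  map_smul' c f := integral_const_mul c f.1

theorem ofMeasure_apply (μ : Measure M) [IsFiniteMeasureOnCompacts μ] (f : Test) :
    ofMeasure μ f = ∫ p, f.1 p ∂μ := rfl

theorem positive_ofMeasure (μ : Measure M) [IsFiniteMeasureOnCompacts μ] :
    Positive (ofMeasure μ) := fun f hf => by
  have h : ∀ p, f.1 p = ((f.1 p).re : ℂ) := fun p =>
    (Complex.eq_re_of_ofReal_le (r := 0) (by simpa using hf p))
  rw [ofMeasure_apply, integral_congr_ae (Filter.Eventually.of_forall h), integral_complex_ofReal]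
  exact Complex.zero_le_real.mpr (integral_nonneg fun p => (Complex.le_def.mp (hf p)).1)

/-- Every compactly supported continuous function is dominated by a real test function. -/
theorem exists_dominating (k : M → ℝ) (hk : Continuous k) (hc : HasCompactSupport k) :
    ∃ χ : M → ℝ, IsSmooth χ ∧ HasCompactSupport χ ∧ (∀ p, 0 ≤ χ p) ∧ ∀ p, |k p| ≤ χ p := by
  obtain ⟨C, hC⟩ := hk.bounded_above_of_compact_support hc
  obtain ⟨χ, h1, h2, h3, -, h4⟩ := exists_cutoff hc isOpen_univ (Set.subset_univ _)
  have h0 : ∀ p, 0 ≤ |C| * χ p := fun p => mul_nonneg (abs_nonneg _) (h4 p).1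
  refine ⟨fun p => |C| * χ p, (isSmooth_const |C|).mul h1, h2.mul_left, h0, fun p => ?_⟩
  by_cases hp : p ∈ tsupport k
  · simp only [h3.self_of_nhdsSet p hp, mul_one]
    exact (hC p).trans (le_abs_self C)
  · rw [image_eq_zero_of_notMem_tsupport hp, abs_zero]
    exact h0 p

/-- With χ dominating |k|, the function k = χ - (χ - k) is a difference of two nonnegative test
functions, on which φ is real. -/
theorem Positive.im_eq_zero {φ : Functional} (hφ : Positive φ) (k : M → ℝ) (hk : IsSmooth k)
    (hc : HasCompactSupport k) : (φ (realTest k hk hc)).im = 0 := by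
  obtain ⟨χ, h1, h2, h3, h4⟩ := exists_dominating k hk.continuous hc
  have a := hφ (realTest χ h1 h2) fun p => Complex.zero_le_real.mpr (h3 p)
  have b := hφ (realTest χ h1 h2 - realTest k hk hc) fun p => by
    change 0 ≤ (χ p : ℂ) - (k p : ℂ)
    rw [← Complex.ofReal_sub]
    exact Complex.zero_le_real.mpr (sub_nonneg.mpr ((le_abs_self _).trans (h4 p)))
  rw [map_sub] at b
  have a' := (Complex.le_def.mp a).2
  have b' := (Complex.le_def.mp b).2
  simp only [Complex.zero_im, Complex.sub_im] at a' b'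
  linarith

/-- The smooth functions among the compactly supported continuous ones. -/
def smoothCc : Submodule ℝ C_c(M, ℝ) where
  carrier := {k | IsSmooth (k : M → ℝ)}
  zero_mem' := isSmooth_const 0
  add_mem' := IsSmooth.add
  smul_mem' c _ h := (isSmooth_const c).mul h

/-- A positive functional as a partially defined functional on `C_c(M, ℝ)`. -/
noncomputable def partialFunctional (φ : Functional) : C_c(M, ℝ) →ₗ.[ℝ] ℝ where
  domain := smoothCc
  toFun :=
    { toFun := fun k => (φ (realTest k.1 k.2 k.1.hasCompactSupport)).re
      map_add' := fun k l => by
        rw [← Complex.add_re, ← map_add]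
        congr 2
        refine Subtype.ext (funext fun p => ?_)
        simp [realTest]
      map_smul' := fun c k => by
        have e : realTest (c • k).1 (c • k).2 (c • k).1.hasCompactSupport
            = (c : ℂ) • realTest k.1 k.2 k.1.hasCompactSupport :=
          Subtype.ext (funext fun p => by simp [realTest])
        rw [e, map_smul]
        simp }

/-- The cone of nonnegative functions in `C_c(M, ℝ)`. -/
def positiveCone : PointedCone ℝ C_c(M, ℝ) where
  carrier := {k | ∀ p, 0 ≤ k p}
  zero_mem' _ := le_rfl
  add_mem' h l p := add_nonneg (h p) (l p)
  smul_mem' c _ h p := mul_nonneg c.2 (h p)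

/-- Smooth functions are cofinal in C_c(M, ℝ) by `exists_dominating`, so M. Riesz extension carries
the functional from smooth to continuous functions without losing positivity. Riesz–Markov then
represents it, and complex test functions are split into real and imaginary parts. -/
theorem exists_measure {φ : Functional} (hφ : Positive φ) :
    ∃ (μ : Measure M) (_ : IsFiniteMeasureOnCompacts μ), φ = ofMeasure μ := by
  obtain ⟨g, hg1, hg2⟩ := riesz_extension positiveCone
    (partialFunctional φ) (fun k hk => by
      have := hφ (realTest k.1.1 k.2 k.1.hasCompactSupport)
        fun p => Complex.zero_le_real.mpr (hk p)
      exact (Complex.le_def.mp this).1)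
    (fun k => by
      obtain ⟨χ, h1, h2, h3, h4⟩ := exists_dominating k k.continuous k.hasCompactSupport
      refine ⟨⟨⟨⟨χ, h1.continuous⟩, h2⟩, h1⟩, fun p => ?_⟩
      change 0 ≤ χ p + k p
      linarith [h4 p, neg_abs_le (k p)])
  let Λ : C_c(M, ℝ) →ₚ[ℝ] ℝ := PositiveLinearMap.mk₀ g hg2
  have hreal : ∀ (k : M → ℝ) (hk : IsSmooth k) (hc : HasCompactSupport k),
      φ (realTest k hk hc) = ((∫ p, k p ∂(RealRMK.rieszMeasure Λ) : ℝ) : ℂ) := fun k hk hc => by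
    have h1 := RealRMK.integral_rieszMeasure Λ ⟨⟨k, hk.continuous⟩, hc⟩
    have h2 := hg1 ⟨⟨⟨k, hk.continuous⟩, hc⟩, hk⟩
    have h3 : (φ (realTest k hk hc)).re = ∫ p, k p ∂(RealRMK.rieszMeasure Λ) := (h1.trans h2).symm
    rw [← h3]
    exact Complex.ext rfl (hφ.im_eq_zero k hk hc)
  refine ⟨RealRMK.rieszMeasure Λ, inferInstance, LinearMap.ext fun f => ?_⟩
  have hre : IsSmooth fun p => (f.1 p).re := Complex.reCLM.contDiff.comp f.2.1
  have him : IsSmooth fun p => (f.1 p).im := Complex.imCLM.contDiff.comp f.2.1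
  have e : f = realTest _ hre (f.2.2.comp_left (g := Complex.re) rfl)
      + Complex.I • realTest _ him (f.2.2.comp_left (g := Complex.im) rfl) := by
    refine Subtype.ext (funext fun p => ?_)
    change f.1 p = (f.1 p).re + Complex.I * (f.1 p).im
    rw [mul_comm, Complex.re_add_im]
  rw [e, map_add, map_add, map_smul, map_smul, hreal, hreal, ofMeasure_apply, ofMeasure_apply]
  simp [realTest, integral_complex_ofReal]

/-- A smooth cutoff is squeezed between the indicators of K and of an open U ⊇ K with ν(U) close to
ν(K). -/
theorem measure_isCompact_le {μ ν : Measure M} [IsFiniteMeasureOnCompacts μ]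
    [IsFiniteMeasureOnCompacts ν] (h : ∀ f : Test, ∫ p, f.1 p ∂μ = ∫ p, f.1 p ∂ν) {K : Set M}
    (hK : IsCompact K) : μ K ≤ ν K := by
  refine le_of_forall_gt fun r hr => ?_
  obtain ⟨U, hKU, hU, hr⟩ := K.exists_isOpen_lt_of_lt r hr
  obtain ⟨χ, h1, h2, h3, h4, h5⟩ := exists_cutoff hK hU hKU
  refine lt_of_le_of_lt ?_ hr
  have hχ := h (realTest χ h1 h2)
  simp only [realTest, integral_complex_ofReal, Complex.ofReal_inj] at hχ
  have hi (ρ : Measure M) [IsFiniteMeasureOnCompacts ρ] :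
      ENNReal.ofReal (∫ p, χ p ∂ρ) = ∫⁻ p, ENNReal.ofReal (χ p) ∂ρ :=
    ofReal_integral_eq_lintegral_ofReal (h1.continuous.integrable_of_hasCompactSupport h2)
      (Filter.Eventually.of_forall fun p => (h5 p).1)
  calc μ K = ∫⁻ p, K.indicator 1 p ∂μ := (lintegral_indicator_one hK.measurableSet).symm
    _ ≤ ∫⁻ p, ENNReal.ofReal (χ p) ∂μ := lintegral_mono fun p => by
        by_cases hp : p ∈ K
        · simp [hp, h3.self_of_nhdsSet p hp]
        · simp [hp]
    _ = ∫⁻ p, ENNReal.ofReal (χ p) ∂ν := by rw [← hi μ, ← hi ν, hχ]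
    _ ≤ ∫⁻ p, U.indicator 1 p ∂ν := lintegral_mono fun p => by
        by_cases hp : p ∈ U
        · simpa [hp] using (h5 p).2
        · simp [hp, h4 p hp]
    _ = ν U := lintegral_indicator_one hU.measurableSet

/-- Outer regularity reduces equality to open sets, and inner regularity of open sets reduces it to
compact ones. -/
theorem measure_ext {μ ν : Measure M} [IsFiniteMeasureOnCompacts μ]
    [IsFiniteMeasureOnCompacts ν] (h : ∀ f : Test, ∫ p, f.1 p ∂μ = ∫ p, f.1 p ∂ν) : μ = ν := by
  refine Measure.OuterRegular.ext_isOpen fun U hU => ?_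
  rw [hU.measure_eq_iSup_isCompact, hU.measure_eq_iSup_isCompact]
  refine iSup_congr fun K => iSup_congr fun _ => iSup_congr fun hK => le_antisymm ?_ ?_
  · exact measure_isCompact_le h hK
  · exact measure_isCompact_le (fun f => (h f).symm) hK

/-! ### The action of `ℝ²` on `M` -/

/-- The flow of `x ∂_x + ∂_θ` for the time `q.1`, composed with the translation of `y` by `q.2`. -/
noncomputable def act (q : ℝ × ℝ) (p : M) : M :=
  (p.1 * Real.exp q.1, p.2.1 + (q.1 : T), p.2.2 + q.2)

theorem act_add (q r : ℝ × ℝ) (p : M) : act q (act r p) = act (r + q) p := by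
  refine Prod.ext ?_ (Prod.ext ?_ ?_)
  · simp [act, Real.exp_add, mul_assoc]
  · simp [act, add_assoc]
  · simp [act, add_assoc]

theorem act_zero (p : M) : act 0 p = p := by simp [act]

theorem continuous_act : Continuous fun z : (ℝ × ℝ) × M => act z.1 z.2 := by
  have := continuous_coe_T
  unfold act
  fun_prop

/-- The action as a homeomorphism. -/
noncomputable def actHomeo (q : ℝ × ℝ) : M ≃ₜ M where
  toFun := act q
  invFun := act (-q)
  left_inv p := by rw [act_add, add_neg_cancel, act_zero]
  right_inv p := by rw [act_add, neg_add_cancel, act_zero]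
  continuous_toFun := continuous_act.comp (Continuous.prodMk_right q)
  continuous_invFun := continuous_act.comp (Continuous.prodMk_right (-q))

theorem isSmooth_comp_act {f : M → ℂ} (hf : IsSmooth f) (q : ℝ × ℝ) :
    IsSmooth fun p => f (act q p) := by
  have e : lift (fun p => f (act q p)) = lift f ∘ fun r : ℝ × ℝ × ℝ =>
      (r.1 * Real.exp q.1, r.2.1 + q.1, r.2.2 + q.2) := by
    funext r; simp [lift, act]
  unfold IsSmooth
  rw [e]
  exact hf.comp (by fun_prop)

/-- The action on test functions. -/
noncomputable def tact (q : ℝ × ℝ) (f : Test) : Test :=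
  ⟨fun p => f.1 (act q p), isSmooth_comp_act f.2.1 q,
    f.2.2.comp_isClosedEmbedding (actHomeo q).isClosedEmbedding⟩

theorem hasDerivAt_act_fst {f : M → ℂ} (hf : IsSmooth f) (p : M) (t : ℝ) :
    HasDerivAt (fun t : ℝ => f (act (t, 0) p)) (spiralDeriv f (act (t, 0) p)) t := by
  simpa [act] using hasDerivAt_spiral hf p.1 p.2.1 p.2.2 t

theorem hasDerivAt_act_snd {f : M → ℂ} (hf : IsSmooth f) (p : M) (t : ℝ) :
    HasDerivAt (fun t : ℝ => f (act (0, t) p)) (dy f (act (0, t) p)) t := by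
  have := (hasDerivAt_dy_line hf p.1 p.2.1 (p.2.2 + t)).comp_const_add p.2.2 t
  simpa [act] using this

/-- A flow commutes with its generator: the derivative of s ↦ f(act (t + s, 0) p) at s = 0 is
computed in two ways. -/
theorem tspiral_tact (t : ℝ) (f : Test) : tspiral (tact (t, 0) f) = tact (t, 0) (tspiral f) := by
  refine Subtype.ext (funext fun p => ?_)
  have h1 := hasDerivAt_act_fst (tact (t, 0) f).2.1 p 0
  have h2 := (hasDerivAt_act_fst f.2.1 p (0 + t)).comp_add_const 0 t
  have h := h1.unique (h2.congr_of_eventuallyEq (Filter.Eventually.of_forall fun s => by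
    simp [tact, act_add]))
  rw [show ((0 : ℝ), (0 : ℝ)) = 0 from rfl, act_zero, zero_add] at h
  exact h

theorem tdy_tact (t : ℝ) (f : Test) : tdy (tact (0, t) f) = tact (0, t) (tdy f) := by
  refine Subtype.ext (funext fun p => ?_)
  have h1 := hasDerivAt_act_snd (tact (0, t) f).2.1 p 0
  have h2 := (hasDerivAt_act_snd f.2.1 p (0 + t)).comp_add_const 0 t
  have h := h1.unique (h2.congr_of_eventuallyEq (Filter.Eventually.of_forall fun s => by
    simp [tact, act_add]))
  rw [show ((0 : ℝ), (0 : ℝ)) = 0 from rfl, act_zero, zero_add] at h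
  exact h

/-- If integration along a one-parameter group multiplies derivatives by `κ`, the integral
transforms with the exponential `e^{κ t}`. -/
theorem integral_act_of_deriv (μ : Measure M) [IsFiniteMeasureOnCompacts μ] (c : ℝ →+ ℝ × ℝ)
    (hc : Continuous c) (f f' : Test) (κ : ℝ)
    (hd : ∀ p t, HasDerivAt (fun t : ℝ => f.1 (act (c t) p)) (f'.1 (act (c t) p)) t)
    (hκ : ∀ t, ∫ p, f'.1 (act (c t) p) ∂μ = κ * ∫ p, f.1 (act (c t) p) ∂μ) (t : ℝ) :
    ∫ p, f.1 (act (c t) p) ∂μ = Real.exp (κ * t) * ∫ p, f.1 p ∂μ := by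
  have hI : ∀ t, HasDerivAt (fun t => ∫ p, f.1 (act (c t) p) ∂μ)
      (κ * ∫ p, f.1 (act (c t) p) ∂μ) t := by
    intro t₀
    obtain ⟨C, hC⟩ := f'.2.1.continuous.bounded_above_of_compact_support f'.2.2
    -- K contains every point that some time within 1 of t₀ moves into the support of f'. It is
    -- compact, so a constant on K is an integrable bound for differentiating under the integral.
    set K : Set M := (fun z : ℝ × M => act (-c z.1) z.2) ''
      (Set.Icc (t₀ - 1) (t₀ + 1) ×ˢ tsupport f'.1) with hKdef
    have hK : IsCompact K := by
      refine (isCompact_Icc.prod f'.2.2).image ?_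
      exact continuous_act.comp (((hc.comp continuous_fst).neg).prodMk continuous_snd)
    have h := (hasDerivAt_integral_of_dominated_loc_of_deriv_le (μ := μ) (x₀ := t₀)
      (F := fun t p => f.1 (act (c t) p)) (F' := fun t p => f'.1 (act (c t) p))
      (s := Set.Icc (t₀ - 1) (t₀ + 1)) (bound := K.indicator fun _ => C)
      (Icc_mem_nhds (by linarith) (by linarith))
      (Filter.Eventually.of_forall fun t =>
        (integrable_test μ (tact (c t) f)).aestronglyMeasurable)
      (integrable_test μ (tact (c t₀) f))
      (integrable_test μ (tact (c t₀) f')).aestronglyMeasurable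
      (Filter.Eventually.of_forall fun p t ht => by
        by_cases hp : act (c t) p ∈ tsupport f'.1
        · have : p ∈ K := ⟨(t, act (c t) p), ⟨ht, hp⟩, by
            simp [act_add, act_zero]⟩
          simpa [this] using hC _
        · rw [image_eq_zero_of_notMem_tsupport hp, norm_zero]
          exact Set.indicator_nonneg (fun _ _ => (norm_nonneg _).trans (hC p)) p)
      ((integrable_indicator_iff hK.measurableSet).mpr
        (integrableOn_const hK.measure_lt_top.ne))
      (Filter.Eventually.of_forall fun p t _ => hd p t)).2
    rwa [hκ] at h
  -- The integral solves I' = κ I, hence e^{-κt} I(t) is constant.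
  have hE : ∀ t, HasDerivAt (fun t : ℝ => (Real.exp (-κ * t) : ℂ) * ∫ p, f.1 (act (c t) p) ∂μ)
      0 t := by
    intro t
    have h1 : HasDerivAt (fun t : ℝ => (Real.exp (-κ * t) : ℂ))
        ((Real.exp (-κ * t) * (-κ * 1) : ℝ) : ℂ) t :=
      ((hasDerivAt_id t).const_mul (-κ)).exp.ofReal_comp
    refine (h1.mul (hI t)).congr_deriv ?_
    push_cast
    ring
  have h := is_const_of_deriv_eq_zero (fun t => (hE t).differentiableAt) (fun t => (hE t).deriv) t 0
  simp only [map_zero, act_zero, mul_zero, Real.exp_zero, Complex.ofReal_one, one_mul] at h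
  rw [← h, ← mul_assoc, ← Complex.ofReal_mul, ← Real.exp_add]
  simp

/-- The translation by q is the composite of the two one-parameter groups, each of which contributes
its own exponential. -/
theorem integral_act {μ : Measure M} [IsFiniteMeasureOnCompacts μ] {γ κ : ℝ}
    (h : IsQuasiInvariant γ κ (ofMeasure μ)) (q : ℝ × ℝ) (f : Test) :
    ∫ p, f.1 (act q p) ∂μ = Real.exp (-γ * q.1 + κ * q.2) * ∫ p, f.1 p ∂μ := by
  have h1 := integral_act_of_deriv μ (AddMonoidHom.inl ℝ ℝ)
    (continuous_id.prodMk continuous_const) (tact (0, q.2) f)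
    (tspiral (tact (0, q.2) f)) (-γ) (fun p t => hasDerivAt_act_fst (tact _ f).2.1 p t)
    (fun t => by
      have := h.1 (tact (t, 0) (tact (0, q.2) f))
      rw [tspiral_tact] at this
      push_cast
      exact this) q.1
  have h2 := integral_act_of_deriv μ (AddMonoidHom.inr ℝ ℝ)
    (continuous_const.prodMk continuous_id) f
    (tdy f) κ (fun p t => hasDerivAt_act_snd f.2.1 p t)
    (fun t => by
      have := h.2 (tact (0, t) f)
      rw [tdy_tact] at this
      exact this) q.2
  have e : ∀ p, f.1 (act q p) = (tact (0, q.2) f).1 (act (AddMonoidHom.inl ℝ ℝ q.1) p) := fun p => by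
    simp [tact, act_add]
  simp_rw [e, h1]
  rw [show (∫ p, (tact (0, q.2) f).1 p ∂μ) = ∫ p, f.1 (act (AddMonoidHom.inr ℝ ℝ q.2) p) ∂μ from rfl,
    h2, ← mul_assoc, ← Complex.ofReal_mul, ← Real.exp_add]

/-- The scaling factor of a quasi-invariant measure. -/
noncomputable def character (γ κ : ℝ) (q : ℝ × ℝ) : ℝ≥0∞ :=
  ENNReal.ofReal (Real.exp (-γ * q.1 + κ * q.2))

theorem measurable_character (γ κ : ℝ) : Measurable (character γ κ) := by
  unfold character; fun_prop

theorem map_act {μ : Measure M} [IsFiniteMeasureOnCompacts μ] {γ κ : ℝ}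
    (h : IsQuasiInvariant γ κ (ofMeasure μ)) (q : ℝ × ℝ) :
    μ.map (act q) = character γ κ q • μ := by
  have i1 : IsFiniteMeasureOnCompacts (μ.map (act q)) :=
    Measure.IsFiniteMeasureOnCompacts.map μ (actHomeo q)
  have i2 : IsFiniteMeasureOnCompacts (character γ κ q • μ) :=
    IsFiniteMeasureOnCompacts.smul μ ENNReal.ofReal_ne_top
  refine measure_ext fun f => ?_
  rw [show act q = actHomeo q from rfl, (actHomeo q).measurableEmbedding.integral_map,
    integral_smul_measure, character,
    ENNReal.toReal_ofReal (Real.exp_pos _).le, Complex.real_smul]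
  exact integral_act h q f

theorem measurable_act (q : ℝ × ℝ) : Measurable (act q) := (actHomeo q).continuous.measurable

theorem lintegral_act {μ : Measure M} [IsFiniteMeasureOnCompacts μ] {γ κ : ℝ}
    (h : IsQuasiInvariant γ κ (ofMeasure μ)) (q : ℝ × ℝ) {f : M → ℝ≥0∞} (hf : Measurable f) :
    ∫⁻ p, f (act q p) ∂μ = character γ κ q * ∫⁻ p, f p ∂μ := by
  rw [← lintegral_map hf (measurable_act q), map_act h, lintegral_smul_measure, smul_eq_mul]

end Spiral

namespace Spiral
open scoped ENNReal

/-! ### The strata `x = 0` and `x ≠ 0` -/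

section Strata

variable {μ : Measure M} [IsFiniteMeasureOnCompacts μ] {γ κ : ℝ}

/-- The compact set `|x| ≤ R`, `|y| ≤ R`. -/
def box (R : ℝ) : Set M := Set.Icc (-R) R ×ˢ (Set.univ ×ˢ Set.Icc (-R) R)

theorem isCompact_box (R : ℝ) : IsCompact (box R) := by
  have := fact_two_pi_pos
  exact isCompact_Icc.prod (isCompact_univ.prod isCompact_Icc)

theorem mem_box {R : ℝ} {p : M} : p ∈ box R ↔ |p.1| ≤ R ∧ |p.2.2| ≤ R := by
  simp [box, abs_le]

theorem exists_mem_box (p : M) : ∃ n : ℕ, p ∈ box n := by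
  obtain ⟨n, hn⟩ := exists_nat_ge (max |p.1| |p.2.2|)
  exact ⟨n, mem_box.mpr (max_le_iff.mp hn)⟩

theorem exists_subset_box {K : Set M} (hK : IsCompact K) : ∃ R : ℝ, 0 ≤ R ∧ K ⊆ box R := by
  have hc : Continuous fun p : M => max |p.1| |p.2.2| := by fun_prop
  obtain ⟨R, hR⟩ := hK.bddAbove_image hc.continuousOn
  refine ⟨max R 0, le_max_right _ _, fun p hp => mem_box.mpr ?_⟩
  exact max_le_iff.mp ((hR ⟨p, hp, rfl⟩).trans (le_max_left _ _))

theorem measurableSet_box (R : ℝ) : MeasurableSet (box R) := (isCompact_box R).measurableSet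

theorem measure_eq_zero_of_box {μ : Measure M} {S : Set M} (h : ∀ n : ℕ, μ (S ∩ box n) = 0) : μ S = 0 := by
  refine measure_mono_null (fun p hp => ?_) (measure_iUnion_null h)
  obtain ⟨n, hn⟩ := exists_mem_box p
  exact Set.mem_iUnion.mpr ⟨n, hp, hn⟩

theorem measurableSet_x_ne : MeasurableSet {p : M | p.1 ≠ 0} :=
  (measurableSet_singleton (0 : ℝ)).compl.preimage measurable_fst

theorem measurableSet_x_eq : MeasurableSet {p : M | p.1 = 0} :=
  (measurableSet_singleton (0 : ℝ)).preimage measurable_fst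

theorem measure_preimage_act (h : IsQuasiInvariant γ κ (ofMeasure μ)) (q : ℝ × ℝ) {S : Set M}
    (hS : MeasurableSet S) : μ (act q ⁻¹' S) = character γ κ q * μ S := by
  rw [← Measure.map_apply (measurable_act q) hS, map_act h]
  rfl

/-- The preimages of W under the times k = 0, 1, 2, … consist of the points with 0 < |x| ≤ n e^{-k}
and |y| ≤ n. They decrease to the empty set, so their measures tend to 0; yet these are e^{-γk}
μ(W), which is at least μ(W) when γ ≤ 0. -/
theorem measure_x_ne_of_nonpos (h : IsQuasiInvariant γ κ (ofMeasure μ)) (hγ : γ ≤ 0) :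
    μ {p | p.1 ≠ 0} = 0 := by
  refine measure_eq_zero_of_box fun n => ?_
  set W : Set M := {p | p.1 ≠ 0} ∩ box n with hW
  have hWm : MeasurableSet W := measurableSet_x_ne.inter (measurableSet_box n)
  set S : ℕ → Set M := fun k => act ((k : ℝ), 0) ⁻¹' W with hS
  have hmem : ∀ k p, p ∈ S k ↔ p.1 ≠ 0 ∧ |p.1| * Real.exp k ≤ n ∧ |p.2.2| ≤ n := fun k p => by
    simp [hS, hW, mem_box, act, abs_mul, Real.exp_ne_zero]
  have hle : ∀ k, μ W ≤ μ (S k) := fun k => by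
    rw [hS, measure_preimage_act h _ hWm]
    refine le_mul_of_one_le_left zero_le ?_
    rw [character, ENNReal.one_le_ofReal, Real.one_le_exp_iff]
    have := mul_nonneg (neg_nonneg.mpr hγ) (Nat.cast_nonneg (α := ℝ) k)
    simpa using this
  have hfin : μ (S 0) ≠ ⊤ := by
    refine ne_top_of_le_ne_top (isCompact_box n).measure_lt_top.ne (measure_mono fun p hp => ?_)
    have := (hmem 0 p).mp hp
    simpa [mem_box] using this.2
  have hanti : Antitone S := fun k l hkl p hp => by
    rw [hmem] at hp ⊢
    refine ⟨hp.1, le_trans ?_ hp.2.1, hp.2.2⟩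
    gcongr
  have hempty : ⋂ k, S k = ∅ := by
    refine Set.eq_empty_of_forall_notMem fun p hp => ?_
    have hp' := fun k => (hmem k p).mp (Set.mem_iInter.mp hp k)
    have hx : 0 < |p.1| := abs_pos.mpr (hp' 0).1
    obtain ⟨k, hk⟩ := exists_nat_gt ((n : ℝ) / |p.1|)
    have h1 := (hp' k).2.1
    have h2 := Real.add_one_le_exp (k : ℝ)
    rw [div_lt_iff₀ hx] at hk
    nlinarith
  have ht := tendsto_measure_iInter_atTop (μ := μ)
    (s := S) (fun k => (hWm.preimage (measurable_act ((k : ℝ), 0))).nullMeasurableSet) hanti ⟨0, hfin⟩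
  rw [hempty, measure_empty] at ht
  exact le_antisymm (ge_of_tendsto' ht hle) zero_le

/-- On x = 0 the flow of D only rotates θ, so bounded pieces of the form |y| ≤ n are invariant.
Their finite measure is multiplied by e^{-γ} ≠ 1 and must vanish. -/
theorem measure_x_eq_of_ne (h : IsQuasiInvariant γ κ (ofMeasure μ)) (hγ : γ ≠ 0) :
    μ {p | p.1 = 0} = 0 := by
  refine measure_eq_zero_of_box fun n => ?_
  set W : Set M := {p | p.1 = 0} ∩ box n with hW
  have hWm : MeasurableSet W := measurableSet_x_eq.inter (measurableSet_box n)
  have hpre : act (1, 0) ⁻¹' W = W := by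
    ext p
    simp only [hW, Set.mem_preimage, Set.mem_inter_iff, Set.mem_ofPred_eq, mem_box, act, mul_eq_zero,
      Real.exp_ne_zero, or_false, add_zero]
    refine and_congr_right fun hp => ?_
    simp [hp]
  have hfin : μ W ≠ ⊤ :=
    ne_top_of_le_ne_top (isCompact_box n).measure_lt_top.ne (measure_mono Set.inter_subset_right)
  have h1 := measure_preimage_act h (1, 0) hWm
  rw [hpre] at h1
  have h2 := congrArg ENNReal.toReal h1
  rw [ENNReal.toReal_mul, character, ENNReal.toReal_ofReal (Real.exp_pos _).le] at h2
  have h3 : Real.exp (-γ * 1 + κ * 0) ≠ 1 := by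
    rw [Ne, Real.exp_eq_one_iff]
    simpa using hγ
  have h4 : (Real.exp (-γ * 1 + κ * 0) - 1) * (μ W).toReal = 0 := by
    linear_combination -h2
  rcases mul_eq_zero.mp h4 with h5 | h5
  · exact absurd (sub_eq_zero.mp h5) h3
  · exact ((ENNReal.toReal_eq_zero_iff _).mp h5).resolve_right hfin

/-- Applied to f = xχ the hypothesis reads ∫ x² χ dμ = 0, with a nonnegative integrand that is
positive wherever x ≠ 0 and χ = 1. -/
theorem measure_x_ne_of_mul (h : ∀ f, ofMeasure μ (tmulX f) = 0) : μ {p | p.1 ≠ 0} = 0 := by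
  refine measure_eq_zero_of_box fun n => ?_
  obtain ⟨χ, h1, h2, h3, -, h5⟩ := exists_cutoff (isCompact_box n) isOpen_univ (Set.subset_univ _)
  have hs : IsSmooth fun p : M => p.1 * (p.1 * χ p) := isSmooth_x.mul (isSmooth_x.mul h1)
  have hc : HasCompactSupport fun p : M => p.1 * (p.1 * χ p) := h2.mul_left.mul_left
  have h0 := h (realTest (fun p => p.1 * χ p) (isSmooth_x.mul h1) h2.mul_left)
  have e : ofMeasure μ (tmulX (realTest (fun p => p.1 * χ p) (isSmooth_x.mul h1) h2.mul_left))
      = ((∫ p, p.1 * (p.1 * χ p) ∂μ : ℝ) : ℂ) := by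
    rw [← integral_complex_ofReal]
    refine integral_congr_ae (Filter.Eventually.of_forall fun p => ?_)
    simp [tmul, realTest]
  rw [e, Complex.ofReal_eq_zero, integral_eq_zero_iff_of_nonneg (fun p => by
    rw [← mul_assoc]
    exact mul_nonneg (mul_self_nonneg p.1) (h5 p).1)
    (hs.continuous.integrable_of_hasCompactSupport hc)] at h0
  refine measure_mono_null (fun p hp => ?_) (ae_iff.mp h0)
  intro hz
  have hz' : p.1 * (p.1 * χ p) = 0 := hz
  rw [h3.self_of_nhdsSet p hp.2, mul_one] at hz'
  exact hp.1 (mul_self_eq_zero.mp hz')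

theorem eq_zero_of_strata {μ : Measure M} (h0 : μ {p | p.1 = 0} = 0) (h1 : μ {p | p.1 ≠ 0} = 0) : μ = 0 := by
  rw [← Measure.measure_univ_eq_zero]
  refine measure_mono_null (fun p _ => ?_) (measure_union_null h0 h1)
  exact em (p.1 = 0)

/-! ### Disintegration along the orbits -/

/-- A quasi-invariant measure is recovered from orbital integrals and a weight `w` with total
mass one on almost every orbit. -/
theorem lintegral_eq_orbital (h : IsQuasiInvariant γ κ (ofMeasure μ)) (l : Measure (ℝ × ℝ))
    [SFinite l] {w : M → ℝ≥0∞} (hw : Measurable w) (hw1 : ∀ᵐ p ∂μ, ∫⁻ q, w (act q p) ∂l = 1)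
    {f : M → ℝ≥0∞} (hf : Measurable f) :
    ∫⁻ p, f p ∂μ = ∫⁻ p, w p * ∫⁻ q, character γ κ q * f (act (-q) p) ∂l ∂μ := by
  have hact : Measurable fun z : M × (ℝ × ℝ) => act z.2 z.1 :=
    (continuous_act.comp continuous_swap).measurable
  have hact' : Measurable fun z : M × (ℝ × ℝ) => act (-z.2) z.1 :=
    (continuous_act.comp (continuous_snd.neg.prodMk continuous_fst)).measurable
  have hchar := measurable_character γ κ
  calc ∫⁻ p, f p ∂μ = ∫⁻ p, ∫⁻ q, f p * w (act q p) ∂l ∂μ := by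
        refine lintegral_congr_ae (hw1.mono fun p hp => ?_)
        simp only
        have hm : Measurable fun q => w (act q p) := hw.comp (hact.comp measurable_prodMk_left)
        rw [lintegral_const_mul _ hm, hp, mul_one]
    _ = ∫⁻ q, ∫⁻ p, f p * w (act q p) ∂μ ∂l :=
        lintegral_lintegral_swap ((hf.comp measurable_fst).mul (hw.comp hact)).aemeasurable
    _ = ∫⁻ q, ∫⁻ p, w p * (character γ κ q * f (act (-q) p)) ∂μ ∂l := by
        refine lintegral_congr fun q => ?_
        -- The translate of this function by q is f(p) w(act q p), so quasi-invariance moves the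
        -- action from w to f at the cost of the character.
        have hm : Measurable fun p => f (act (-q) p) * w p :=
          (hf.comp (measurable_act _)).mul hw
        have := lintegral_act h q hm
        simp only [act_add, add_neg_cancel, act_zero] at this
        rw [this, ← lintegral_const_mul _ hm]
        exact lintegral_congr fun p => by ring
    _ = ∫⁻ p, ∫⁻ q, w p * (character γ κ q * f (act (-q) p)) ∂l ∂μ :=
        (lintegral_lintegral_swap ((hw.comp measurable_fst).mul
          ((hchar.comp measurable_snd).mul (hf.comp hact'))).aemeasurable).symm
    _ = _ := by
        refine lintegral_congr fun p => ?_
        exact lintegral_const_mul _ (hchar.mul (hf.comp (hact'.comp measurable_prodMk_left)))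

end Strata

/-! ### The ray over `x = 0` -/

/-- The measure `e^{-κ y} dθ dy` on the stratum `x = 0`. -/
noncomputable def rayMeasure (κ : ℝ) : Measure M :=
  (((volume : Measure ℝ).restrict (Set.Ioc 0 (2 * Real.pi))).prod
    ((volume : Measure ℝ).withDensity fun y => ENNReal.ofReal (Real.exp (-(κ * y))))).map
    fun q => (0, (q.1 : T), q.2)

theorem measurable_ray : Measurable fun q : ℝ × ℝ => ((0, (q.1 : T), q.2) : M) := by
  have := continuous_coe_T
  exact Continuous.measurable (by fun_prop)

theorem lintegral_rayMeasure (κ : ℝ) {f : M → ℝ≥0∞} (hf : Measurable f) :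
    ∫⁻ p, f p ∂rayMeasure κ = ∫⁻ u in Set.Ioc 0 (2 * Real.pi),
      ∫⁻ y, ENNReal.ofReal (Real.exp (-(κ * y))) * f (0, (u : T), y) := by
  have hm : Measurable fun q : ℝ × ℝ => f (0, (q.1 : T), q.2) := hf.comp measurable_ray
  rw [rayMeasure, lintegral_map hf measurable_ray, lintegral_prod _ hm.aemeasurable]
  refine lintegral_congr fun u => ?_
  exact lintegral_withDensity_eq_lintegral_mul _ (by fun_prop) (hm.comp measurable_prodMk_left)

theorem rayMeasure_box_lt_top (κ R : ℝ) : rayMeasure κ (box R) < ⊤ := by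
  rw [rayMeasure, Measure.map_apply measurable_ray (measurableSet_box R)]
  refine lt_of_le_of_lt (measure_mono (t := Set.univ ×ˢ Set.Icc (-R) R) ?_) ?_
  · rintro ⟨u, y⟩ hq
    exact ⟨trivial, abs_le.mp (mem_box.mp hq).2⟩
  · rw [Measure.prod_prod]
    refine ENNReal.mul_lt_top (by simp [ENNReal.mul_lt_top]) ?_
    rw [withDensity_apply _ measurableSet_Icc]
    have hi : IntegrableOn (fun y => Real.exp (-(κ * y))) (Set.Icc (-R) R) :=
      Continuous.integrableOn_Icc (by fun_prop)
    exact hi.lintegral_lt_top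

instance isFiniteMeasureOnCompacts_rayMeasure (κ : ℝ) :
    IsFiniteMeasureOnCompacts (rayMeasure κ) := ⟨fun K hK => by
  obtain ⟨R, -, hR⟩ := exists_subset_box hK
  exact (measure_mono hR).trans_lt (rayMeasure_box_lt_top κ R)⟩

theorem volume_shift_Ico (y : ℝ) : volume {s : ℝ | y + s ∈ Set.Ico (0 : ℝ) 1} = 1 := by
  have : {s : ℝ | y + s ∈ Set.Ico (0 : ℝ) 1} = Set.Ico (-y) (1 - y) := by
    ext s
    simp only [Set.mem_ofPred_eq, Set.mem_Ico]
    constructor <;> rintro ⟨h1, h2⟩ <;> constructor <;> linarith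
  rw [this, Real.volume_Ico]
  simp

/-- Over a full period this is an integral for Haar measure on the circle, which is invariant under
θ - ·. -/
theorem lintegral_circle_sub {H : T → ℝ≥0∞} (θ : T) :
    ∫⁻ u in Set.Ioc 0 (2 * Real.pi), H (θ - (u : T))
      = ∫⁻ u in Set.Ioc 0 (2 * Real.pi), H (u : T) := by
  have := fact_two_pi_pos
  have h1 := AddCircle.lintegral_preimage (2 * Real.pi) 0 H
  have h2 := AddCircle.lintegral_preimage (2 * Real.pi) 0 fun u => H (θ - u)
  rw [zero_add] at h1 h2
  rw [h1, h2, lintegral_sub_left_eq_self]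

/-- A quasi-invariant measure on the stratum `x = 0` is a multiple of `rayMeasure`. -/
theorem exists_eq_smul_rayMeasure {μ : Measure M} [IsFiniteMeasureOnCompacts μ] {κ : ℝ}
    (h : IsQuasiInvariant 0 κ (ofMeasure μ)) : ∃ c : ℝ≥0, μ = c • rayMeasure κ := by
  have hx := measure_x_ne_of_nonpos h le_rfl
  have hx' : ∀ᵐ p ∂μ, p.1 = 0 := by
    rw [ae_iff]
    exact hx
  set Y : Set M := {p | p.2.2 ∈ Set.Ico (0 : ℝ) 1} with hY
  have hYm : MeasurableSet Y := measurableSet_Ico.preimage (measurable_snd.comp measurable_snd)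
  set d : ℝ≥0∞ := ENNReal.ofReal (2 * Real.pi) with hd
  have hd0 : d ≠ 0 := by
    rw [hd, Ne, ENNReal.ofReal_eq_zero, not_le]; exact Real.two_pi_pos
  set w : M → ℝ≥0∞ := Y.indicator fun _ => d⁻¹ with hw
  have hwm : Measurable w := measurable_const.indicator hYm
  -- On x = 0 the times in 2πℤ act trivially, so u runs over one period only; otherwise orbital
  -- integrals of w would be infinite. The factor 1/(2π) in w compensates for the length of the
  -- period.
  set l : Measure (ℝ × ℝ) :=
    ((volume : Measure ℝ).restrict (Set.Ioc 0 (2 * Real.pi))).prod volume with hl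
  have hw1 : ∀ p : M, ∫⁻ q, w (act q p) ∂l = 1 := fun p => by
    have e : (fun q => w (act q p))
        = (Set.univ ×ˢ {s : ℝ | p.2.2 + s ∈ Set.Ico (0 : ℝ) 1}).indicator fun _ => d⁻¹ := by
      funext q
      simp [hw, hY, Set.indicator_apply, act]
    have hm : MeasurableSet {s : ℝ | p.2.2 + s ∈ Set.Ico (0 : ℝ) 1} :=
      measurableSet_Ico.preimage (measurable_const_add _)
    rw [e, lintegral_indicator_const (MeasurableSet.univ.prod hm), hl, Measure.prod_prod,
      volume_shift_Ico, Measure.restrict_apply_univ, Real.volume_Ioc, sub_zero, mul_one,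
      ENNReal.inv_mul_cancel hd0 ENNReal.ofReal_ne_top]
  set C : ℝ≥0∞ := ∫⁻ p, w p * ENNReal.ofReal (Real.exp (κ * p.2.2)) ∂μ with hC
  have hCm : Measurable fun p : M => w p * ENNReal.ofReal (Real.exp (κ * p.2.2)) :=
    hwm.mul (by fun_prop)
  -- On x = 0 the weight lives in the compact set `box 1`, where e^{κy} is at most e^{|κ|}.
  have hCtop : C ≠ ⊤ := by
    have hb : ∀ᵐ p ∂μ, w p * ENNReal.ofReal (Real.exp (κ * p.2.2))
        ≤ (box 1).indicator (fun _ => d⁻¹ * ENNReal.ofReal (Real.exp |κ|)) p := by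
      filter_upwards [hx'] with p hp
      by_cases hpY : p ∈ Y
      · have hpY' : 0 ≤ p.2.2 ∧ p.2.2 < 1 := hpY
        have hb : p ∈ box 1 := mem_box.mpr ⟨by simp [hp], abs_le.mpr ⟨by linarith, hpY'.2.le⟩⟩
        simp only [hw, Set.indicator_of_mem hpY, Set.indicator_of_mem hb]
        gcongr
        calc κ * p.2.2 ≤ |κ| * p.2.2 := by
              exact mul_le_mul_of_nonneg_right (le_abs_self κ) hpY'.1
          _ ≤ |κ| * 1 := mul_le_mul_of_nonneg_left hpY'.2.le (abs_nonneg κ)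
          _ = |κ| := mul_one _
      · simp [hw, hpY]
    refine ne_top_of_le_ne_top ?_ (lintegral_mono_ae hb)
    rw [lintegral_indicator_const (measurableSet_box 1)]
    exact ENNReal.mul_ne_top (ENNReal.mul_ne_top (ENNReal.inv_ne_top.mpr hd0)
      ENNReal.ofReal_ne_top) (isCompact_box 1).measure_lt_top.ne
  refine ⟨C.toNNReal, Measure.ext fun S hS => ?_⟩
  set f : M → ℝ≥0∞ := S.indicator 1 with hfdef
  have hf : Measurable f := measurable_one.indicator hS
  -- By transitivity the orbital integral through p depends on p only through e^{κy}: substitute θ -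
  -- u for u and y - s for s.
  have hcirc (p : M) (hp : p.1 = 0) : ∫⁻ q, character 0 κ q * f (act (-q) p) ∂l
      = ENNReal.ofReal (Real.exp (κ * p.2.2)) * ∫⁻ p, f p ∂rayMeasure κ := by
    have hmeas : Measurable fun q => character 0 κ q * f (act (-q) p) :=
      (measurable_character 0 κ).mul (hf.comp
        (continuous_act.comp (continuous_neg.prodMk continuous_const)).measurable)
    rw [hl, lintegral_prod _ hmeas.aemeasurable, lintegral_rayMeasure κ hf]
    rw [← lintegral_circle_sub (H := fun θ => ∫⁻ y, ENNReal.ofReal (Real.exp (-(κ * y)))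
      * f (0, θ, y)) p.2.1, ← lintegral_const_mul' _ _ ENNReal.ofReal_ne_top]
    refine lintegral_congr fun u => ?_
    rw [← lintegral_sub_left_eq_self _ p.2.2, ← lintegral_const_mul' _ _ ENNReal.ofReal_ne_top]
    refine lintegral_congr fun s => ?_
    rw [← mul_assoc, ← ENNReal.ofReal_mul (Real.exp_pos _).le, ← Real.exp_add, character]
    congr 2
    · congr 1; simp only; ring
    · simp [act, hp, sub_eq_add_neg]
  have hmain := lintegral_eq_orbital h l hwm (Filter.Eventually.of_forall hw1) hf
  have h2 : ∫⁻ p, w p * ∫⁻ q, character 0 κ q * f (act (-q) p) ∂l ∂μ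
      = C * ∫⁻ p, f p ∂rayMeasure κ := by
    rw [hC, ← lintegral_mul_const _ hCm]
    refine lintegral_congr_ae (hx'.mono fun p hp => ?_)
    simp only
    rw [hcirc p hp, mul_assoc]
  rw [h2, hfdef, lintegral_indicator_one hS, lintegral_indicator_one hS] at hmain
  rw [hmain, Measure.smul_apply, ENNReal.smul_def, smul_eq_mul, ENNReal.coe_toNNReal hCtop]

end Spiral

namespace Spiral
open scoped ENNReal

/-! ### Leafwise measures on the stratum `x ≠ 0` -/

/-- The parametrisation `(θ, (u, y)) ↦ (x e^u, θ + u, y)` of the leaves. -/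
noncomputable def leafPoint (x : ℝ) (z : T × (ℝ × ℝ)) : M :=
  (x * Real.exp z.2.1, z.1 + (z.2.1 : T), z.2.2)

theorem continuous_leafPoint (x : ℝ) : Continuous (leafPoint x) := by
  have := continuous_coe_T
  unfold leafPoint
  fun_prop

/-- The measure `e^{γ u} du dy` on `ℝ²`. -/
noncomputable def expMeasure (γ : ℝ) : Measure (ℝ × ℝ) :=
  (volume : Measure (ℝ × ℝ)).withDensity fun q => ENNReal.ofReal (Real.exp (γ * q.1))

instance sFinite_expMeasure (γ : ℝ) : SFinite (expMeasure γ) := by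
  unfold expMeasure; infer_instance

/-- The measure on `M` which integrates the leafwise functionals against `ν`. -/
noncomputable def leafMeasure (x γ : ℝ) (ν : Measure T) : Measure M :=
  (ν.prod (expMeasure γ)).map (leafPoint x)

theorem lintegral_leafMeasure (x γ : ℝ) (ν : Measure T) {f : M → ℝ≥0∞}
    (hf : Measurable f) : ∫⁻ p, f p ∂leafMeasure x γ ν
      = ∫⁻ θ, (∫⁻ q : ℝ × ℝ, ENNReal.ofReal (Real.exp (γ * q.1)) * f (leafPoint x (θ, q))) ∂ν := by
  have hm : Measurable fun z => f (leafPoint x z) := hf.comp (continuous_leafPoint x).measurable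
  rw [leafMeasure, lintegral_map hf (continuous_leafPoint x).measurable,
    lintegral_prod _ hm.aemeasurable]
  refine lintegral_congr fun θ => ?_
  exact lintegral_withDensity_eq_lintegral_mul _ (by fun_prop) (hm.comp measurable_prodMk_left)

/-- Here γ > 0 is indispensable: it makes e^{γu} integrable at u = -∞, the end at which a leaf
accumulates on x = 0. -/
theorem expMeasure_lt_top {γ : ℝ} (hγ : 0 < γ) (a R : ℝ) :
    expMeasure γ (Set.Iic a ×ˢ Set.Icc (-R) R) < ⊤ := by
  rw [expMeasure, withDensity_apply _ (measurableSet_Iic.prod measurableSet_Icc)]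
  have h1 : IntegrableOn (fun u => Real.exp (γ * u)) (Set.Iic a) := integrableOn_exp_mul_Iic hγ a
  have h2 : IntegrableOn (fun _ : ℝ => (1 : ℝ)) (Set.Icc (-R) R) :=
    integrableOn_const (by simp)
  have h := Integrable.mul_prod h1 h2
  rw [Measure.prod_restrict] at h
  simp only [mul_one] at h
  exact h.lintegral_lt_top

/-- A bound on |x| e^u bounds u from above only, which suffices by `expMeasure_lt_top`. -/
theorem isFiniteMeasureOnCompacts_leafMeasure {x γ : ℝ} (hx : x ≠ 0) (hγ : 0 < γ) (ν : Measure T)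
    [IsFiniteMeasure ν] : IsFiniteMeasureOnCompacts (leafMeasure x γ ν) := ⟨fun K hK => by
  obtain ⟨R, -, hR⟩ := exists_subset_box hK
  refine (measure_mono hR).trans_lt ?_
  rw [leafMeasure, Measure.map_apply (continuous_leafPoint x).measurable (measurableSet_box R)]
  refine lt_of_le_of_lt
    (measure_mono (t := Set.univ ×ˢ (Set.Iic (Real.log (R / |x|)) ×ˢ Set.Icc (-R) R)) ?_) ?_
  · rintro ⟨θ, u, y⟩ hz
    have hz' := mem_box.mp hz
    refine ⟨trivial, ?_, abs_le.mp hz'.2⟩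
    have h1 : |x| * Real.exp u ≤ R := by simpa [leafPoint, abs_mul] using hz'.1
    have h2 : Real.exp u ≤ R / |x| := by
      rwa [le_div_iff₀ (abs_pos.mpr hx), mul_comm]
    exact (Real.le_log_iff_exp_le ((Real.exp_pos u).trans_le h2)).mpr h2
  · rw [Measure.prod_prod]
    exact ENNReal.mul_lt_top (measure_lt_top _ _) (expMeasure_lt_top hγ _ _)⟩

/-- A set which meets each leaf of sign `τ` and base point in `E` in a fundamental window. -/
def window (τ : ℝ) (E : Set T) : Set M :=
  {p | τ * p.1 ∈ Set.Ico 1 (Real.exp 1) ∧ p.2.1 - (Real.log |p.1| : T) ∈ E ∧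
    p.2.2 ∈ Set.Ico (0 : ℝ) 1}

theorem measurable_base : Measurable fun p : M => p.2.1 - ((Real.log |p.1| : ℝ) : T) := by
  have h1 : Measurable fun p : M => ((Real.log |p.1| : ℝ) : T) :=
    continuous_coe_T.measurable.comp (Real.measurable_log.comp measurable_fst.abs)
  exact (measurable_fst.comp measurable_snd).sub h1

theorem measurableSet_window (τ : ℝ) {E : Set T} (hE : MeasurableSet E) :
    MeasurableSet (window τ E) :=
  (measurableSet_Ico.preimage (measurable_fst.const_mul τ)).inter
    ((hE.preimage measurable_base).inter
      (measurableSet_Ico.preimage (measurable_snd.comp measurable_snd)))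

/-- The `expMeasure` of the unit square. -/
noncomputable def windowMass (γ : ℝ) : ℝ≥0∞ :=
  expMeasure γ (Set.Ico (0 : ℝ) 1 ×ˢ Set.Ico (0 : ℝ) 1)

theorem windowMass_ne_zero (γ : ℝ) : windowMass γ ≠ 0 := by
  rw [windowMass, expMeasure, Ne, withDensity_apply_eq_zero' (by fun_prop)]
  have e : {q : ℝ × ℝ | ENNReal.ofReal (Real.exp (γ * q.1)) ≠ 0} = Set.univ := by
    ext q
    simp [Real.exp_pos]
  rw [e, Set.univ_inter, Measure.volume_eq_prod, Measure.prod_prod]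
  simp

theorem windowMass_ne_top {γ : ℝ} (hγ : 0 < γ) : windowMass γ ≠ ⊤ := by
  refine ne_top_of_le_ne_top (expMeasure_lt_top hγ 1 1).ne (measure_mono ?_)
  rintro ⟨u, y⟩ ⟨hu, hy⟩
  exact ⟨hu.2.le, by linarith [hy.1], hy.2.le⟩

/-- At the point (τ e^u, θ + u, y) one has log |x| = u, so the base point is θ and the window pulls
back to E times the unit square. -/
theorem leafMeasure_window_self {τ : ℝ} (hτ : τ = 1 ∨ τ = -1) (γ : ℝ) (ν : Measure T) [SFinite ν]
    {E : Set T} (hE : MeasurableSet E) :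
    leafMeasure τ γ ν (window τ E) = ν E * windowMass γ := by
  rw [leafMeasure, Measure.map_apply (continuous_leafPoint τ).measurable
    (measurableSet_window τ hE), windowMass, ← Measure.prod_prod]
  congr 1
  ext ⟨θ, u, y⟩
  have h1 : τ * (τ * Real.exp u) = Real.exp u := by rcases hτ with rfl | rfl <;> ring
  have h2 : |τ * Real.exp u| = Real.exp u := by rcases hτ with rfl | rfl <;> simp
  simp only [window, leafPoint, Set.mem_preimage, Set.mem_ofPred_eq, Set.mem_prod, h1, h2,
    Real.log_exp, add_sub_cancel_right, Set.mem_Ico, Real.one_le_exp_iff, Real.exp_lt_exp]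
  tauto

theorem leafMeasure_window_neg {τ : ℝ} (hτ : τ = 1 ∨ τ = -1) (γ : ℝ) (ν : Measure T)
    {E : Set T} (hE : MeasurableSet E) :
    leafMeasure (-τ) γ ν (window τ E) = 0 := by
  rw [leafMeasure, Measure.map_apply (continuous_leafPoint _).measurable
    (measurableSet_window τ hE)]
  convert measure_empty (μ := ν.prod (expMeasure γ))
  refine Set.eq_empty_of_forall_notMem ?_
  rintro ⟨θ, u, y⟩ hz
  have h1 : τ * (-τ * Real.exp u) = -Real.exp u := by rcases hτ with rfl | rfl <;> ring
  have h2 : (1 : ℝ) ≤ τ * (-τ * Real.exp u) := hz.1.1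
  linarith [Real.exp_pos u]

/-- Each window sees a single sign of x, and there it returns ν(E) times a constant that is neither
zero nor infinite. -/
theorem leafMeasure_injective {γ : ℝ} (hγ : 0 < γ) {ν₁ ν₂ ν₁' ν₂' : Measure T}
    [SFinite ν₁] [SFinite ν₂] [SFinite ν₁'] [SFinite ν₂']
    (h : leafMeasure 1 γ ν₁ + leafMeasure (-1) γ ν₂
      = leafMeasure 1 γ ν₁' + leafMeasure (-1) γ ν₂') : ν₁ = ν₁' ∧ ν₂ = ν₂' := by
  have hc := windowMass_ne_zero γ
  have ht := windowMass_ne_top hγ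
  have r : (-1 : ℝ) = 1 ∨ (-1 : ℝ) = -1 := Or.inr rfl
  have l : (1 : ℝ) = 1 ∨ (1 : ℝ) = -1 := Or.inl rfl
  refine ⟨Measure.ext fun E hE => ?_, Measure.ext fun E hE => ?_⟩
  · have h' := congrArg (fun ρ : Measure M => ρ (window 1 E)) h
    simp only [Measure.add_apply, leafMeasure_window_self l γ _ hE,
      leafMeasure_window_neg l γ _ hE, add_zero] at h'
    exact (ENNReal.mul_left_inj hc ht).mp h'
  · have h' := congrArg (fun ρ : Measure M => ρ (window (-1) E)) h
    have hn (ν : Measure T) : leafMeasure 1 γ ν (window (-1) E) = 0 := by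
      simpa using leafMeasure_window_neg r γ ν hE
    simp only [Measure.add_apply, leafMeasure_window_self r γ _ hE, hn, zero_add] at h'
    exact (ENNReal.mul_left_inj hc ht).mp h'

/-- The orbital integral through a point, in terms of the leaf of its base point. -/
theorem lintegral_orbit {σ : ℝ} (γ : ℝ) (f : M → ℝ≥0∞) {p : M}
    (hp : p.1 ≠ 0) (hs : p.1 = σ * |p.1|) :
    ∫⁻ q, character γ 0 q * f (act (-q) p) = ENNReal.ofReal (Real.exp (-(γ * Real.log |p.1|))) *
      ∫⁻ q : ℝ × ℝ, ENNReal.ofReal (Real.exp (γ * q.1))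
        * f (leafPoint σ (p.2.1 - (Real.log |p.1| : T), q)) := by
  rw [← lintegral_sub_left_eq_self (fun q : ℝ × ℝ => ENNReal.ofReal (Real.exp (γ * q.1))
    * f (leafPoint σ (p.2.1 - (Real.log |p.1| : T), q))) (Real.log |p.1|, p.2.2),
    ← lintegral_const_mul' _ _ ENNReal.ofReal_ne_top]
  refine lintegral_congr fun q => ?_
  rw [← mul_assoc, ← ENNReal.ofReal_mul (Real.exp_pos _).le, ← Real.exp_add, character]
  congr 2
  · congr 1
    simp only [Prod.fst_sub]
    ring
  · refine Prod.ext ?_ (Prod.ext ?_ ?_)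
    · change p.1 * Real.exp (-q.1) = σ * Real.exp (Real.log |p.1| - q.1)
      rw [sub_eq_add_neg, Real.exp_add, Real.exp_log (abs_pos.mpr hp), ← mul_assoc, ← hs]
    · simp [act, leafPoint, sub_eq_add_neg, add_assoc]
    · simp [act, leafPoint, sub_eq_add_neg]

/-- The weight is the indicator of 1 ≤ |x| < e, 0 ≤ y < 1; in the coordinates (log |x|, y) of an
orbit it is a unit square. By `lintegral_orbit` the orbital integral through p equals |x|^{-γ} times
an integral depending only on the sign of x and the base point. Hence the weighted measure may be
pushed forward to the circle, one sign at a time. -/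
theorem exists_eq_leafMeasure {μ : Measure M} [IsFiniteMeasureOnCompacts μ] {γ : ℝ} (hγ : 0 < γ)
    (h : IsQuasiInvariant γ 0 (ofMeasure μ)) : ∃ ν₁ ν₂ : Measure T, IsFiniteMeasure ν₁ ∧
      IsFiniteMeasure ν₂ ∧ μ = leafMeasure 1 γ ν₁ + leafMeasure (-1) γ ν₂ := by
  have hx : ∀ᵐ p ∂μ, p.1 ≠ 0 := by
    rw [ae_iff]
    simpa using measure_x_eq_of_ne h hγ.ne'
  set W : Set M := {p | |p.1| ∈ Set.Ico 1 (Real.exp 1) ∧ p.2.2 ∈ Set.Ico (0 : ℝ) 1} with hW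
  have hWm : MeasurableSet W := (measurableSet_Ico.preimage measurable_fst.abs).inter
    (measurableSet_Ico.preimage (measurable_snd.comp measurable_snd))
  set w : M → ℝ≥0∞ := W.indicator 1 with hw
  have hwm : Measurable w := measurable_one.indicator hWm
  have hw1 : ∀ᵐ p ∂μ, ∫⁻ q, w (act q p) = 1 := by
    filter_upwards [hx] with p hp
    have e : (fun q => w (act q p)) = ({u : ℝ | Real.log |p.1| + u ∈ Set.Ico (0 : ℝ) 1} ×ˢ
        {s : ℝ | p.2.2 + s ∈ Set.Ico (0 : ℝ) 1}).indicator fun _ => 1 := by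
      funext q
      have e1 : |p.1 * Real.exp q.1| = Real.exp (Real.log |p.1| + q.1) := by
        rw [Real.exp_add, Real.exp_log (abs_pos.mpr hp), abs_mul, abs_of_pos (Real.exp_pos _)]
      simp only [hw, hW, Set.indicator_apply, act, e1, Set.mem_ofPred_eq, Set.mem_Ico,
        Real.one_le_exp_iff, Real.exp_lt_exp, Set.mem_prod, Pi.one_apply]
    have hm (a : ℝ) : MeasurableSet {s : ℝ | a + s ∈ Set.Ico (0 : ℝ) 1} :=
      measurableSet_Ico.preimage (measurable_const_add _)
    rw [e, lintegral_indicator_const ((hm _).prod (hm _)), Measure.volume_eq_prod,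
      Measure.prod_prod, volume_shift_Ico, volume_shift_Ico]
    simp
  -- The weight times the factor |x|^{-γ} from `lintegral_orbit`. It is at most 1, as |x| ≥ 1 where
  -- w ≠ 0, and this makes the measures on the circle finite.
  set d : M → ℝ≥0∞ := fun p => w p * ENNReal.ofReal (Real.exp (-(γ * Real.log |p.1|))) with hd
  have hdm : Measurable d := hwm.mul (ENNReal.measurable_ofReal.comp
    (Real.measurable_exp.comp ((Real.measurable_log.comp measurable_fst.abs).const_mul γ).neg))
  set S : ℝ → Set M := fun σ => {p | 0 < σ * p.1} with hS
  have hSm : ∀ σ, MeasurableSet (S σ) := fun σ =>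
    measurableSet_Ioi.preimage (measurable_fst.const_mul σ)
  set ν : ℝ → Measure T := fun σ => ((μ.restrict (S σ)).withDensity d).map
    fun p => p.2.1 - ((Real.log |p.1| : ℝ) : T) with hν
  have hfin : ∀ σ, IsFiniteMeasure (ν σ) := fun σ => by
    refine ⟨?_⟩
    rw [hν, Measure.map_apply measurable_base MeasurableSet.univ, Set.preimage_univ,
      withDensity_apply _ MeasurableSet.univ, setLIntegral_univ]
    refine lt_of_le_of_lt (lintegral_mono' Measure.restrict_le_self (g := (box (Real.exp 1)).indicator 1)
      fun p => ?_) ?_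
    · by_cases hp : p ∈ W
      · have hb : p ∈ box (Real.exp 1) := mem_box.mpr ⟨hp.1.2.le, by
          rw [abs_of_nonneg hp.2.1]
          exact hp.2.2.le.trans (Real.one_le_exp zero_le_one)⟩
        simp only [hd, hw, Set.indicator_of_mem hp, Set.indicator_of_mem hb, Pi.one_apply, one_mul]
        rw [ENNReal.ofReal_le_one, Real.exp_le_one_iff, neg_nonpos]
        exact mul_nonneg hγ.le (Real.log_nonneg hp.1.1)
      · simp [hd, hw, hp]
    · rw [lintegral_indicator_one (measurableSet_box _)]
      exact (isCompact_box _).measure_lt_top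
  have hside : ∀ σ : ℝ, (σ = 1 ∨ σ = -1) → ∀ f : M → ℝ≥0∞, Measurable f →
      ∫⁻ p in S σ, w p * (∫⁻ q, character γ 0 q * f (act (-q) p)) ∂μ
        = ∫⁻ p, f p ∂leafMeasure σ γ (ν σ) := fun σ hσ f hf => by
    have hL : Measurable fun θ : T => ∫⁻ q : ℝ × ℝ, ENNReal.ofReal (Real.exp (γ * q.1))
        * f (leafPoint σ (θ, q)) := by
      refine Measurable.lintegral_prod_right' (f := fun z : T × (ℝ × ℝ) =>
        ENNReal.ofReal (Real.exp (γ * z.2.1)) * f (leafPoint σ z)) ?_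
      exact Measurable.mul (by fun_prop) (hf.comp (continuous_leafPoint σ).measurable)
    rw [lintegral_leafMeasure σ γ _ hf, hν, lintegral_map hL measurable_base]
    refine Eq.trans ?_
      (lintegral_withDensity_eq_lintegral_mul _ hdm (hL.comp measurable_base)).symm
    refine setLIntegral_congr_fun (hSm σ) fun p hp => ?_
    have hp' : 0 < σ * p.1 := hp
    have hp0 : p.1 ≠ 0 := fun h0 => by simp [h0] at hp'
    have hs : p.1 = σ * |p.1| := by
      rcases hσ with rfl | rfl
      · rw [abs_of_pos (by simpa using hp')]; ring
      · rw [abs_of_neg (by linarith)]; ring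
    rw [lintegral_orbit γ f hp0 hs, ← mul_assoc]
    rfl
  refine ⟨ν 1, ν (-1), hfin 1, hfin (-1), Measure.ext fun E hE => ?_⟩
  set f : M → ℝ≥0∞ := E.indicator 1 with hfdef
  have hf : Measurable f := measurable_one.indicator hE
  have hmain := lintegral_eq_orbital h volume hwm hw1 hf
  have hae : (S 1 ∪ S (-1) : Set M) =ᵐ[μ] Set.univ := by
    rw [ae_eq_univ]
    refine measure_mono_null (fun p hp => ?_) (ae_iff.mp hx)
    intro hp0
    refine hp ?_
    rcases lt_or_gt_of_ne hp0 with h0 | h0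
    · exact Or.inr (by change 0 < -1 * p.1; linarith)
    · exact Or.inl (by change 0 < 1 * p.1; linarith)
  have hdisj : Disjoint (S 1) (S (-1)) := by
    refine Set.disjoint_left.mpr fun p h1 h2 => ?_
    have h1' : 0 < 1 * p.1 := h1
    have h2' : 0 < -1 * p.1 := h2
    linarith
  rw [← setLIntegral_univ (μ := μ) (fun p => w p * _), ← setLIntegral_congr hae,
    lintegral_union (hSm (-1)) hdisj, hside 1 (Or.inl rfl) f hf, hside (-1) (Or.inr rfl) f hf,
    hfdef, lintegral_indicator_one hE, lintegral_indicator_one hE,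
    lintegral_indicator_one hE] at hmain
  rw [hmain, Measure.add_apply]

/-! ### The functional over `x = 0` -/

theorem integrable_ray (κ : ℝ) (f : Test) : Integrable (fun q : ℝ × ℝ => f.1 (0, (q.1 : T), q.2))
    (((volume : Measure ℝ).restrict (Set.Ioc 0 (2 * Real.pi))).prod
      ((volume : Measure ℝ).withDensity fun y => ENNReal.ofReal (Real.exp (-(κ * y))))) :=
  (integrable_test (rayMeasure κ) f).comp_measurable measurable_ray

theorem integral_rayMeasure (κ : ℝ) (f : Test) : ∫ p, f.1 p ∂rayMeasure κ =
    ∫ θ in (0 : ℝ)..(2 * Real.pi), ∫ y : ℝ, f.1 (0, (θ : T), y) * (Real.exp (-(κ * y)) : ℂ) := by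
  rw [rayMeasure, integral_map measurable_ray.aemeasurable
    f.2.1.continuous.aestronglyMeasurable, integral_prod _ (integrable_ray κ f),
    intervalIntegral.integral_of_le Real.two_pi_pos.le]
  refine integral_congr_ae (Filter.Eventually.of_forall fun θ => ?_)
  simp only
  rw [integral_withDensity_eq_integral_toReal_smul (by fun_prop) (by simp)]
  refine integral_congr_ae (Filter.Eventually.of_forall fun y => ?_)
  simp only
  rw [ENNReal.toReal_ofReal (Real.exp_pos _).le, Complex.real_smul, mul_comm]

theorem continuous_ray : Continuous fun q : ℝ × ℝ => ((0, (q.1 : T), q.2) : M) := by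
  have := continuous_coe_T
  fun_prop

theorem hcs_slice_y {f : M → ℂ} (hf : HasCompactSupport f) (x : ℝ) (θ : T) :
    HasCompactSupport fun y : ℝ => f (x, θ, y) := by
  have h : IsCompact ((fun p : M => p.2.2) '' tsupport f) := hf.image (by fun_prop)
  refine HasCompactSupport.intro h fun y hy => ?_
  by_contra hne
  exact hy ⟨(x, θ, y), subset_tsupport f hne, rfl⟩

theorem continuous_slice_y {f : M → ℂ} (hf : Continuous f) (x : ℝ) (θ : T) :
    Continuous fun y : ℝ => f (x, θ, y) := by fun_prop

theorem rayMeasure_ne_zero (κ : ℝ) : rayMeasure κ ≠ 0 := by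
  intro h
  have h1 := lintegral_rayMeasure κ (f := fun _ => 1) measurable_const
  rw [h, lintegral_zero_measure, eq_comm] at h1
  have h2 : (∫⁻ y : ℝ, ENNReal.ofReal (Real.exp (-(κ * y)))) = 0 := by
    simpa [Real.pi_pos.not_ge] using h1
  rw [lintegral_eq_zero_iff (by fun_prop)] at h2
  have h3 : ∀ᵐ y : ℝ, False := h2.mono fun y hy => by
    simp [(Real.exp_pos _).not_ge] at hy
  rw [Filter.eventually_false_iff_eq_bot, ae_eq_bot] at h3
  exact NeZero.ne (volume : Measure ℝ) h3

/-- On x = 0 the field D is ∂_θ, whose integral over a period vanishes. For ∂_y, integration by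
parts against e^{-κy} produces κ. -/
theorem rayMeasure_quasiInvariant (κ : ℝ) : IsQuasiInvariant 0 κ (ofMeasure (rayMeasure κ)) := by
  refine ⟨fun f => ?_, fun f => ?_⟩
  · rw [Complex.ofReal_zero, neg_zero, zero_mul, ofMeasure_apply, rayMeasure, integral_map measurable_ray.aemeasurable
      (tspiral f).2.1.continuous.aestronglyMeasurable, integral_prod_symm _ (integrable_ray κ (tspiral f))]
    refine integral_eq_zero_of_ae (Filter.Eventually.of_forall fun y => ?_)
    simp only [Pi.zero_apply]
    rw [← intervalIntegral.integral_of_le Real.two_pi_pos.le]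
    have hd : ∀ u ∈ Set.uIcc 0 (2 * Real.pi), HasDerivAt (fun u : ℝ => f.1 (0, (u : T), y))
        ((tspiral f).1 (0, (u : T), y)) u := fun u _ => by
      simpa [tspiral] using hasDerivAt_spiral f.2.1 0 0 y u
    rw [intervalIntegral.integral_eq_sub_of_hasDerivAt hd
      ((((tspiral f).2.1.continuous.comp continuous_ray).comp
        (Continuous.prodMk_left y)).intervalIntegrable 0 (2 * Real.pi))]
    rw [AddCircle.coe_period, AddCircle.coe_zero, sub_self]
  · rw [ofMeasure_apply, ofMeasure_apply, integral_rayMeasure, integral_rayMeasure,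
      ← intervalIntegral.integral_const_mul]
    refine intervalIntegral.integral_congr fun u _ => ?_
    have i1 : Integrable fun y : ℝ => f.1 (0, (u : T), y) * (Real.exp (-(κ * y)) : ℂ) :=
      Continuous.integrable_of_hasCompactSupport
        ((continuous_slice_y f.2.1.continuous 0 u).mul (by fun_prop))
        ((hcs_slice_y f.2.2 0 u).mul_right)
    have i2 : Integrable fun y : ℝ => (tdy f).1 (0, (u : T), y) * (Real.exp (-(κ * y)) : ℂ) :=
      Continuous.integrable_of_hasCompactSupport
        ((continuous_slice_y (tdy f).2.1.continuous 0 u).mul (by fun_prop))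
        ((hcs_slice_y (tdy f).2.2 0 u).mul_right)
    have hd : ∀ y : ℝ, HasDerivAt (fun y : ℝ => f.1 (0, (u : T), y) * (Real.exp (-(κ * y)) : ℂ))
        ((tdy f).1 (0, (u : T), y) * (Real.exp (-(κ * y)) : ℂ)
          - κ * (f.1 (0, (u : T), y) * (Real.exp (-(κ * y)) : ℂ))) y := fun y => by
      have h1 : HasDerivAt (fun y : ℝ => (Real.exp (-(κ * y)) : ℂ))
          ((Real.exp (-(κ * y)) * -(κ * 1) : ℝ) : ℂ) y :=
        (((hasDerivAt_id y).const_mul κ).neg).exp.ofReal_comp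
      refine ((hasDerivAt_dy_line f.2.1 0 (u : T) y).mul h1).congr_deriv ?_
      simp only [tdy]
      push_cast
      ring
    have h0 := integral_eq_zero_of_hasDerivAt_of_integrable hd (i2.sub (i1.const_mul _)) i1
    rw [integral_sub i2 (i1.const_mul _), integral_const_mul] at h0
    exact sub_eq_zero.mp h0

theorem ofMeasure_rayMeasure_mem (A : ℝ) {β : ℝ} (hβ : 0 < β) :
    ofMeasure (rayMeasure (A * β)) ∈ KMS (X₀ A 0) β := by
  rw [mem_KMS_X₀_iff hβ, zero_mul]
  refine ⟨positive_ofMeasure _, rayMeasure_quasiInvariant _, fun f => ?_⟩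
  rw [ofMeasure_apply, integral_rayMeasure]
  simp [tmul]

/-! ### The leafwise functionals -/

section Leaf

variable {x γ : ℝ}

theorem integrable_leafPoint (hx : x ≠ 0) (hγ : 0 < γ) (ν : Measure T) [IsFiniteMeasure ν]
    (f : Test) : Integrable (fun z => f.1 (leafPoint x z)) (ν.prod (expMeasure γ)) := by
  have := isFiniteMeasureOnCompacts_leafMeasure hx hγ ν
  exact (integrable_test (leafMeasure x γ ν) f).comp_measurable
    (continuous_leafPoint x).measurable

theorem leafIntegrand_eq (x : ℝ) (θ : T) (γ : ℝ) (f : Test) (q : ℝ × ℝ) :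
    leafIntegrand x θ γ f q
      = (ENNReal.ofReal (Real.exp (γ * q.1))).toReal • f.1 (leafPoint x (θ, q)) := by
  rw [ENNReal.toReal_ofReal (Real.exp_pos _).le, Complex.real_smul, mul_comm]
  rfl

/-- The case of a Dirac measure in `integrable_leafPoint`, with the density e^{γu} moved into the
integrand. -/
theorem integrable_leafIntegrand (hx : x ≠ 0) (hγ : 0 < γ) (θ : T) (f : Test) :
    Integrable (leafIntegrand x θ γ f) := by
  have h := integrable_leafPoint hx hγ (Measure.dirac θ) f
  rw [Measure.dirac_prod] at h
  have h1 := h.comp_measurable measurable_prodMk_left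
  rw [expMeasure] at h1
  have h2 := (integrable_withDensity_iff_integrable_smul' (by fun_prop) (by simp)).mp h1
  rw [funext (leafIntegrand_eq x θ γ f)]
  exact h2

theorem leafFun_eq_integral (x : ℝ) (θ : T) (γ : ℝ) (f : Test) :
    leafFun x θ γ f = ∫ q, f.1 (leafPoint x (θ, q)) ∂expMeasure γ := by
  rw [expMeasure, integral_withDensity_eq_integral_toReal_smul (by fun_prop) (by simp), leafFun]
  simp only [leafIntegrand_eq]

theorem integrable_leafFun (hx : x ≠ 0) (hγ : 0 < γ) (ν : Measure T) [IsFiniteMeasure ν]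
    (f : Test) : Integrable (fun θ => leafFun x θ γ f) ν := by
  simp only [leafFun_eq_integral]
  exact (integrable_leafPoint hx hγ ν f).integral_prod_left

theorem integral_leafMeasure (hx : x ≠ 0) (hγ : 0 < γ) (ν : Measure T) [IsFiniteMeasure ν]
    (f : Test) : ∫ p, f.1 p ∂leafMeasure x γ ν = ∫ θ, leafFun x θ γ f ∂ν := by
  rw [leafMeasure, integral_map (continuous_leafPoint x).measurable.aemeasurable
    f.2.1.continuous.aestronglyMeasurable, integral_prod _ (integrable_leafPoint hx hγ ν f)]
  simp only [leafFun_eq_integral]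

/-- The sum of the integrands of Df and γ f is the u-derivative of f e^{γu} along the leaf. The
support need not be compact in u, so the vanishing of the integral rests on the integrability of the
function and its derivative on almost every line. -/
theorem leafFun_spiral (hx : x ≠ 0) (hγ : 0 < γ) (θ : T) (f : Test) :
    leafFun x θ γ (tspiral f) = -γ * leafFun x θ γ f := by
  have i1 := integrable_leafIntegrand hx hγ θ f
  have i2 := integrable_leafIntegrand hx hγ θ (tspiral f)
  have h : ∫ q, (leafIntegrand x θ γ (tspiral f) q + γ * leafIntegrand x θ γ f q) = 0 := by
    have i : Integrable
        fun q => leafIntegrand x θ γ (tspiral f) q + γ * leafIntegrand x θ γ f q :=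
      i2.add (i1.const_mul (γ : ℂ))
    rw [Measure.volume_eq_prod] at i i1 ⊢
    rw [integral_prod_symm _ i]
    refine integral_eq_zero_of_ae ?_
    filter_upwards [i.prod_left_ae, i1.prod_left_ae] with y h1 h2
    refine integral_eq_zero_of_hasDerivAt_of_integrable (fun u => ?_) h1 h2
    have he : HasDerivAt (fun u : ℝ => (Real.exp (γ * u) : ℂ))
        ((Real.exp (γ * u) * (γ * 1) : ℝ) : ℂ) u :=
      (((hasDerivAt_id u).const_mul γ)).exp.ofReal_comp
    refine ((hasDerivAt_spiral f.2.1 x θ y u).mul he).congr_deriv ?_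
    simp only [leafIntegrand, tspiral]
    push_cast
    ring
  rw [integral_add i2 (i1.const_mul _), integral_const_mul] at h
  exact (eq_neg_of_add_eq_zero_left h).trans (neg_mul _ _).symm

theorem leafFun_dy (hx : x ≠ 0) (hγ : 0 < γ) (θ : T) (f : Test) :
    leafFun x θ γ (tdy f) = 0 := by
  have i1 := integrable_leafIntegrand hx hγ θ f
  have i2 := integrable_leafIntegrand hx hγ θ (tdy f)
  rw [leafFun]
  rw [Measure.volume_eq_prod] at i2 i1 ⊢
  rw [integral_prod _ i2]
  refine integral_eq_zero_of_ae ?_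
  filter_upwards [i1.prod_right_ae, i2.prod_right_ae] with u h1 h2
  refine integral_eq_zero_of_hasDerivAt_of_integrable (fun y => ?_) h2 h1
  exact (hasDerivAt_dy_line f.2.1 (x * Real.exp u) (θ + (u : T)) y).mul_const
    (Real.exp (γ * u) : ℂ)

/-- A finite superposition of leafwise functionals. -/
noncomputable def leafFunctional (hx : x ≠ 0) (hγ : 0 < γ) (ν : Measure T) [IsFiniteMeasure ν] :
    Functional :=
  have := isFiniteMeasureOnCompacts_leafMeasure hx hγ ν
  ofMeasure (leafMeasure x γ ν)

theorem leafFunctional_apply (hx : x ≠ 0) (hγ : 0 < γ) (ν : Measure T) [IsFiniteMeasure ν]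
    (f : Test) : leafFunctional hx hγ ν f = ∫ θ, leafFun x θ γ f ∂ν :=
  integral_leafMeasure hx hγ ν f

theorem leafFunctional_mem {B β : ℝ} (hx : x ≠ 0) (hβ : 0 < β) (hγ : 0 < B * β) (ν : Measure T)
    [IsFiniteMeasure ν] : leafFunctional hx hγ ν ∈ KMS (X₀ 0 B) β := by
  rw [mem_KMS_X₀_iff hβ]
  refine ⟨?_, ⟨fun f => ?_, fun f => ?_⟩, fun f => by simp⟩
  · have := isFiniteMeasureOnCompacts_leafMeasure hx hγ ν
    exact positive_ofMeasure _
  · simp only [leafFunctional_apply, leafFun_spiral hx hγ]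
    exact integral_const_mul _ _
  · simp [leafFunctional_apply, leafFun_dy hx hγ]

end Leaf

/-! ### Extremal vectors -/

/-- Extremal elements of an abstract cone. -/
def IsExtremalVec {V : Type*} [AddCommMonoid V] [Module ℝ≥0 V] (v : V) : Prop :=
  v ≠ 0 ∧ ∀ a b : V, v = a + b → ∃ c₁ c₂ : ℝ≥0, a = c₁ • v ∧ b = c₂ • v

section ExtremalVec

variable {V W : Type*} [AddCommMonoid V] [Module ℝ≥0 V] [AddCommMonoid W] [Module ℝ≥0 W]

theorem IsExtremalVec.map {v : V} (h : IsExtremalVec v) (e : V ≃ₗ[ℝ≥0] W) :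
    IsExtremalVec (e v) := by
  refine ⟨by simpa using h.1, fun a b hab => ?_⟩
  obtain ⟨c₁, c₂, h1, h2⟩ := h.2 (e.symm a) (e.symm b) (by
    rw [← map_add, ← hab, e.symm_apply_apply])
  refine ⟨c₁, c₂, ?_, ?_⟩
  · rw [← map_smul, ← h1, e.apply_symm_apply]
  · rw [← map_smul, ← h2, e.apply_symm_apply]

theorem isExtremalVec_map_iff {v : V} (e : V ≃ₗ[ℝ≥0] W) :
    IsExtremalVec (e v) ↔ IsExtremalVec v :=
  ⟨fun h => by simpa using h.map e.symm, fun h => h.map e⟩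

theorem isExtremal_iff {C : Submodule ℝ≥0 Functional} (φ : C) :
    IsExtremal C φ ↔ IsExtremalVec φ := by
  constructor
  · rintro ⟨-, h1, h2⟩
    refine ⟨fun h => h1 (by rw [h]; rfl), fun a b hab => ?_⟩
    obtain ⟨c₁, c₂, e1, e2⟩ := h2 a a.2 b b.2 (by rw [hab]; rfl)
    exact ⟨c₁, c₂, Subtype.ext e1, Subtype.ext e2⟩
  · rintro ⟨h1, h2⟩
    refine ⟨φ.2, fun h => h1 (Subtype.ext h), fun a ha b hb hab => ?_⟩
    obtain ⟨c₁, c₂, e1, e2⟩ := h2 ⟨a, ha⟩ ⟨b, hb⟩ (Subtype.ext hab)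
    exact ⟨c₁, c₂, congrArg Subtype.val e1, congrArg Subtype.val e2⟩

theorem eq_zero_of_smul {c : ℝ≥0} (hc : c ≠ 0) {v : V} (h : c • v = 0) : v = 0 := by
  rw [← one_smul ℝ≥0 v, ← inv_mul_cancel₀ hc, mul_smul, h, smul_zero]

/-- The extremal elements of a product of two salient cones. -/
theorem isExtremalVec_prod_iff (hV : ∀ a b : V, a + b = 0 → a = 0 ∧ b = 0)
    (hW : ∀ a b : W, a + b = 0 → a = 0 ∧ b = 0) (v : V × W) :
    IsExtremalVec v ↔ (IsExtremalVec v.1 ∧ v.2 = 0) ∨ (v.1 = 0 ∧ IsExtremalVec v.2) := by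
  obtain ⟨v, w⟩ := v
  constructor
  · rintro ⟨h0, h⟩
    -- The relation (v, 0) = c (v, w) forces v = 0 if c = 0, and w = 0 otherwise.
    obtain ⟨c, -, hc, -⟩ := h (v, 0) (0, w) (by simp)
    rw [Prod.smul_mk, Prod.mk.injEq] at hc
    by_cases hc0 : c = 0
    · right
      have hv : v = 0 := by rw [hc.1, hc0, zero_smul]
      subst hv
      refine ⟨rfl, fun hw => h0 (by rw [show w = 0 from hw]; rfl), fun a b hab => ?_⟩
      obtain ⟨c₁, c₂, e1, e2⟩ := h (0, a) (0, b) (by simpa using hab)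
      exact ⟨c₁, c₂, congrArg Prod.snd e1, congrArg Prod.snd e2⟩
    · left
      have hw : w = 0 := eq_zero_of_smul hc0 hc.2.symm
      subst hw
      refine ⟨⟨fun hv => h0 (by rw [show v = 0 from hv]; rfl), fun a b hab => ?_⟩, rfl⟩
      obtain ⟨c₁, c₂, e1, e2⟩ := h (a, 0) (b, 0) (by simpa using hab)
      exact ⟨c₁, c₂, congrArg Prod.fst e1, congrArg Prod.fst e2⟩
  · rintro (⟨⟨h0, h⟩, hw⟩ | ⟨hv, h0, h⟩)
    · refine ⟨fun hz => h0 (congrArg Prod.fst hz), fun a b hab => ?_⟩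
      rw [Prod.ext_iff] at hab
      obtain ⟨c₁, c₂, e1, e2⟩ := h a.1 b.1 hab.1
      have hz := hW a.2 b.2 (hab.2.symm.trans hw)
      exact ⟨c₁, c₂, Prod.ext e1 (by simp [hz.1, show w = 0 from hw]),
        Prod.ext e2 (by simp [hz.2, show w = 0 from hw])⟩
    · refine ⟨fun hz => h0 (congrArg Prod.snd hz), fun a b hab => ?_⟩
      rw [Prod.ext_iff] at hab
      obtain ⟨c₁, c₂, e1, e2⟩ := h a.2 b.2 hab.2
      have hz := hV a.1 b.1 (hab.1.symm.trans hv)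
      exact ⟨c₁, c₂, Prod.ext (by simp [hz.1, show v = 0 from hv]) e1,
        Prod.ext (by simp [hz.2, show v = 0 from hv]) e2⟩

end ExtremalVec

/-! ### Extreme rays of the cone of finite measures on the circle -/

theorem measT_add_eq_zero (a b : MeasT) (h : a + b = 0) : a = 0 ∧ b = 0 := by
  have h1 : a.mass + b.mass = 0 := by
    have h2 : (a + b).mass = a.mass + b.mass := by
      rw [FiniteMeasure.mass, FiniteMeasure.coeFn_add]; rfl
    rw [← h2, h, FiniteMeasure.zero_mass]
  rw [add_eq_zero] at h1
  exact ⟨a.mass_zero_iff.mp h1.1, b.mass_zero_iff.mp h1.2⟩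

/-- The Dirac measure on the circle. -/
noncomputable def diracT (θ : T) : MeasT := ⟨Measure.dirac θ, inferInstance⟩

theorem diracT_compl (θ : T) : diracT θ {θ}ᶜ = 0 := by
  simp [diracT]

theorem eq_smul_diracT {ν : MeasT} {θ : T} (h : ν {θ}ᶜ = 0) : ν = ν.mass • diracT θ := by
  have h' : (ν : Measure T) {θ}ᶜ = 0 := (ν.null_iff_toMeasure_null _).mp h
  refine FiniteMeasure.eq_of_forall_toMeasure_apply_eq _ _ fun S hS => ?_
  rw [FiniteMeasure.toMeasure_smul, Measure.smul_apply, ENNReal.smul_def, FiniteMeasure.ennreal_mass]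
  have hd : ((diracT θ : MeasT) : Measure T) S = S.indicator 1 θ := Measure.dirac_apply' θ hS
  rw [hd]
  by_cases hθ : θ ∈ S
  · rw [Set.indicator_of_mem hθ, Pi.one_apply, smul_eq_mul, mul_one]
    have h2 : (ν : Measure T) Sᶜ = 0 := measure_mono_null (Set.subset_compl_singleton_iff.mpr fun h => h hθ) h'
    rw [← measure_add_measure_compl hS, h2, add_zero]
  · rw [Set.indicator_of_notMem hθ, smul_zero]
    exact measure_mono_null (Set.subset_compl_singleton_iff.mpr hθ) h'

theorem diracT_ne_zero (θ : T) : diracT θ ≠ 0 := by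
  intro h
  have h2 : Measure.dirac θ Set.univ = (0 : Measure T) Set.univ :=
    congrArg (fun ν : MeasT => (ν : Measure T) Set.univ) h
  simp at h2

/-- Splitting an extremal ν into its restrictions to S and to the complement shows that one of the
two is null. Countably many measurable sets separate the points of the circle, so the identity is
almost everywhere constant and ν sits at one point. Conversely, both summands of c δ_θ vanish off θ,
hence are multiples of δ_θ. -/
theorem isExtremalVec_measT_iff (ν : MeasT) :
    IsExtremalVec ν ↔ ∃ c : ℝ≥0, 0 < c ∧ ∃ θ, ν = c • diracT θ := by
  constructor
  · rintro ⟨h0, h⟩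
    have h01 : ∀ S : Set T, MeasurableSet S → ν S = 0 ∨ ν Sᶜ = 0 := fun S hS => by
      obtain ⟨c, -, hc, -⟩ := h (ν.restrict S) (ν.restrict Sᶜ) (by
        rw [← FiniteMeasure.restrict_union disjoint_compl_right hS.compl, Set.union_compl_self,
          FiniteMeasure.restrict_univ])
      by_cases hc0 : c = 0
      · left
        rwa [hc0, zero_smul, FiniteMeasure.restrict_eq_zero_iff] at hc
      · right
        have := congrArg (fun ρ : MeasT => ρ Sᶜ) hc
        simp only [FiniteMeasure.restrict_apply _ _ hS.compl, Set.compl_inter_self,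
          FiniteMeasure.smul_apply, smul_eq_mul] at this
        rw [show ν ∅ = 0 by simp, eq_comm, mul_eq_zero] at this
        exact this.resolve_left hc0
    obtain ⟨θ, hθ⟩ := Filter.exists_eventuallyEq_const_of_forall_separating
      (l := ae (ν : Measure T)) (f := id) MeasurableSet fun S hS => by
        rcases h01 S hS with h1 | h1
        · right
          rw [Filter.Eventually, mem_ae_iff]
          convert (ν.null_iff_toMeasure_null _).mp h1 using 2
          ext x
          simp
        · left
          rw [Filter.Eventually, mem_ae_iff]
          simpa using (ν.null_iff_toMeasure_null _).mp h1
    have hν : ν {θ}ᶜ = 0 := by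
      rw [FiniteMeasure.null_iff_toMeasure_null]
      exact hθ
    exact ⟨ν.mass, pos_iff_ne_zero.mpr (ν.mass_nonzero_iff.mpr h0), θ, eq_smul_diracT hν⟩
  · rintro ⟨c, hc, θ, rfl⟩
    refine ⟨fun hz => diracT_ne_zero θ (eq_zero_of_smul hc.ne' hz), fun a b hab => ?_⟩
    have h1 : a {θ}ᶜ + b {θ}ᶜ = 0 := by
      rw [← Pi.add_apply, ← FiniteMeasure.coeFn_add, ← hab, FiniteMeasure.smul_apply, diracT_compl,
        smul_zero]
    rw [add_eq_zero] at h1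
    have key : ∀ ρ : MeasT, ρ {θ}ᶜ = 0 → ρ = (ρ.mass / c) • (c • diracT θ) := fun ρ hρ => by
      rw [smul_smul, div_mul_cancel₀ _ hc.ne']
      exact eq_smul_diracT hρ
    exact ⟨a.mass / c, b.mass / c, key a h1.1, key b h1.2⟩

/-! ### The cones of KMS functionals -/

theorem exists_measure_of_mem {A B β : ℝ} (hβ : 0 < β) {φ : Functional}
    (hφ : φ ∈ KMS (X₀ A B) β) : ∃ (μ : Measure M) (_ : IsFiniteMeasureOnCompacts μ),
      φ = ofMeasure μ ∧ IsQuasiInvariant (B * β) (A * β) (ofMeasure μ) ∧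
      ∀ f, A * ofMeasure μ (tmulX f) = 0 := by
  obtain ⟨h0, h1, h2⟩ := (mem_KMS_X₀_iff hβ φ).mp hφ
  obtain ⟨μ, hμ, rfl⟩ := exists_measure h0
  exact ⟨μ, hμ, rfl, h1, h2⟩

theorem ofMeasure_injective {μ ν : Measure M} [IsFiniteMeasureOnCompacts μ]
    [IsFiniteMeasureOnCompacts ν] (h : ofMeasure μ = ofMeasure ν) : μ = ν :=
  measure_ext fun f => congrArg (fun φ : Functional => φ f) h

theorem ofMeasure_eq_zero {μ : Measure M} [IsFiniteMeasureOnCompacts μ] (h : μ = 0) :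
    ofMeasure μ = 0 := by
  refine LinearMap.ext fun f => ?_
  rw [ofMeasure_apply, h, integral_zero_measure]
  rfl

/-- Since B ≠ 0, the stratum x = 0 is null. The stratum x ≠ 0 is null by contraction if B < 0, and
by A φ(xf) = 0 if A ≠ 0. -/
theorem KMS_X₀_eq_bot {A B β : ℝ} (hβ : 0 < β) (h : B < 0 ∨ (0 < B ∧ A ≠ 0)) :
    KMS (X₀ A B) β = ⊥ := by
  refine (Submodule.eq_bot_iff _).mpr fun φ hφ => ?_
  obtain ⟨μ, hμ, rfl, hq, hx⟩ := exists_measure_of_mem hβ hφ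
  refine ofMeasure_eq_zero (eq_zero_of_strata ?_ ?_)
  · refine measure_x_eq_of_ne hq (mul_ne_zero ?_ hβ.ne')
    rcases h with h | h
    exacts [h.ne, h.1.ne']
  · rcases h with h | h
    · exact measure_x_ne_of_nonpos hq (mul_neg_of_neg_of_pos h hβ).le
    · refine measure_x_ne_of_mul fun f => ?_
      exact (mul_eq_zero.mp (hx f)).resolve_left (by exact_mod_cast h.2)

/-- For `B = 0` the cone is a ray. -/
theorem exists_rayEquiv (A : ℝ) {β : ℝ} (hβ : 0 < β) :
    ∃ e : ℝ≥0 ≃ₗ[ℝ≥0] KMS (X₀ A 0) β, ∀ (c : ℝ≥0) (f : Test),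
      (e c : Functional) f = (c : ℂ) * ∫ θ in (0 : ℝ)..(2 * Real.pi), ∫ y : ℝ,
        f.1 (0, (θ : T), y) * (Real.exp (-(A * β * y)) : ℂ) := by
  let φ₀ : KMS (X₀ A 0) β := ⟨_, ofMeasure_rayMeasure_mem A hβ⟩
  have hφ₀ : ∀ (c : ℝ≥0) (f : Test), ((c • φ₀ : KMS (X₀ A 0) β) : Functional) f
      = (c : ℂ) * ∫ p, f.1 p ∂rayMeasure (A * β) := fun c f => by
    change c • ∫ p, f.1 p ∂rayMeasure (A * β) = _
    rw [NNReal.smul_def, Complex.real_smul]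
  have hbij : Function.Bijective (LinearMap.toSpanSingleton ℝ≥0 (KMS (X₀ A 0) β) φ₀) := by
    constructor
    · intro c c' h
      -- A test function with nonzero integral recovers the scalar c.
      have hf : ∃ f : Test, ∫ p, f.1 p ∂rayMeasure (A * β) ≠ 0 := by
        by_contra! hz
        refine rayMeasure_ne_zero (A * β) (measure_ext fun f => ?_)
        rw [hz, integral_zero_measure]
      obtain ⟨f, hf⟩ := hf
      have h1 := congrArg (fun φ : KMS (X₀ A 0) β => (φ : Functional) f) h
      simp only [LinearMap.toSpanSingleton_apply, hφ₀] at h1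
      exact_mod_cast mul_right_cancel₀ hf h1
    · rintro ⟨φ, hφ⟩
      obtain ⟨μ, hμ, rfl, hq, -⟩ := exists_measure_of_mem hβ hφ
      rw [zero_mul] at hq
      obtain ⟨c, hc⟩ := exists_eq_smul_rayMeasure hq
      refine ⟨c, Subtype.ext (LinearMap.ext fun f => ?_)⟩
      rw [LinearMap.toSpanSingleton_apply, hφ₀, ofMeasure_apply, hc, integral_smul_nnreal_measure,
        NNReal.smul_def, Complex.real_smul]
  refine ⟨LinearEquiv.ofBijective _ hbij, fun c f => ?_⟩
  rw [LinearEquiv.ofBijective_apply, LinearMap.toSpanSingleton_apply, hφ₀, integral_rayMeasure]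

theorem neg_one_ne_zero_real : (-1 : ℝ) ≠ 0 := by norm_num

/-- The linear map from pairs of measures on the circle to KMS functionals. -/
noncomputable def leafMap {B β : ℝ} (hβ : 0 < β) (hB : 0 < B) :
    (MeasT × MeasT) →ₗ[ℝ≥0] KMS (X₀ 0 B) β where
  toFun ν := ⟨leafFunctional one_ne_zero (mul_pos hB hβ) ν.1
      + leafFunctional neg_one_ne_zero_real (mul_pos hB hβ) ν.2,
    add_mem (leafFunctional_mem _ hβ _ _) (leafFunctional_mem _ hβ _ _)⟩
  map_add' ν ρ := by
    have h (x : ℝ) (hx : x ≠ 0) (a b : MeasT) (f : Test) :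
        ∫ θ, leafFun x θ (B * β) f ∂((a + b : MeasT) : Measure T)
          = (∫ θ, leafFun x θ (B * β) f ∂(a : Measure T))
            + ∫ θ, leafFun x θ (B * β) f ∂(b : Measure T) := by
      rw [FiniteMeasure.toMeasure_add]
      exact integral_add_measure (integrable_leafFun hx (mul_pos hB hβ) _ f)
        (integrable_leafFun hx (mul_pos hB hβ) _ f)
    refine Subtype.ext (LinearMap.ext fun f => ?_)
    simp only [Submodule.coe_add, LinearMap.add_apply, leafFunctional_apply, Prod.fst_add,
      Prod.snd_add, h 1 one_ne_zero, h (-1) neg_one_ne_zero_real]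
    ring
  map_smul' c ν := by
    refine Subtype.ext (LinearMap.ext fun f => ?_)
    simp only [Submodule.coe_smul, LinearMap.add_apply, LinearMap.smul_apply, leafFunctional_apply,
      Prod.smul_fst, Prod.smul_snd, FiniteMeasure.toMeasure_smul, integral_smul_nnreal_measure,
      RingHom.id_apply, smul_add]

theorem leafMap_apply {B β : ℝ} (hβ : 0 < β) (hB : 0 < B) (ν : MeasT × MeasT) (f : Test) :
    (leafMap hβ hB ν : Functional) f = (∫ θ, leafFun 1 θ (B * β) f ∂(ν.1 : Measure T))
      + ∫ θ, leafFun (-1) θ (B * β) f ∂(ν.2 : Measure T) := by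
  simp only [leafMap, LinearMap.coe_mk, AddHom.coe_mk, LinearMap.add_apply, leafFunctional_apply]

theorem leafMap_measure {B β : ℝ} (hβ : 0 < β) (hB : 0 < B) (ν : MeasT × MeasT) :
    ∃ _ : IsFiniteMeasureOnCompacts
        (leafMeasure 1 (B * β) (ν.1 : Measure T) + leafMeasure (-1) (B * β) (ν.2 : Measure T)),
      (leafMap hβ hB ν : Functional) = ofMeasure
        (leafMeasure 1 (B * β) (ν.1 : Measure T) + leafMeasure (-1) (B * β) (ν.2 : Measure T)) := by
  have hγ := mul_pos hB hβ
  have i1 := isFiniteMeasureOnCompacts_leafMeasure one_ne_zero hγ (ν.1 : Measure T)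
  have i2 := isFiniteMeasureOnCompacts_leafMeasure neg_one_ne_zero_real hγ (ν.2 : Measure T)
  refine ⟨⟨fun K hK => ENNReal.add_lt_top.mpr ⟨hK.measure_lt_top, hK.measure_lt_top⟩⟩,
    LinearMap.ext fun f => ?_⟩
  rw [leafMap_apply, ofMeasure_apply, integral_add_measure (integrable_test _ f)
    (integrable_test _ f), integral_leafMeasure one_ne_zero hγ,
    integral_leafMeasure neg_one_ne_zero_real hγ]

/-- Functionals determine their measures, so injectivity is `leafMeasure_injective`; surjectivity is
the disintegration `exists_eq_leafMeasure`. -/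
theorem leafMap_bijective {B β : ℝ} (hβ : 0 < β) (hB : 0 < B) :
    Function.Bijective (leafMap hβ hB) := by
  have hγ := mul_pos hB hβ
  constructor
  · intro ν ρ h
    obtain ⟨i1, h1⟩ := leafMap_measure hβ hB ν
    obtain ⟨i2, h2⟩ := leafMap_measure hβ hB ρ
    have h3 := leafMeasure_injective hγ (ofMeasure_injective (h1.symm.trans ((congrArg _ h).trans h2)))
    exact Prod.ext (FiniteMeasure.toMeasure_injective h3.1) (FiniteMeasure.toMeasure_injective h3.2)
  · rintro ⟨φ, hφ⟩
    obtain ⟨μ, hμ, rfl, hq, -⟩ := exists_measure_of_mem hβ hφ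
    rw [zero_mul] at hq
    obtain ⟨ν₁, ν₂, h1, h2, h⟩ := exists_eq_leafMeasure hγ hq
    refine ⟨(⟨ν₁, h1⟩, ⟨ν₂, h2⟩), Subtype.ext ?_⟩
    obtain ⟨i, hi⟩ := leafMap_measure hβ hB (⟨ν₁, h1⟩, ⟨ν₂, h2⟩)
    rw [hi]
    refine LinearMap.ext fun f => ?_
    rw [ofMeasure_apply, ofMeasure_apply, h]
    rfl

/-- For `A = 0` and `B > 0` the cone is isomorphic to the pairs of measures on the circle. -/
noncomputable def leafEquiv {B β : ℝ} (hβ : 0 < β) (hB : 0 < B) :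
    (MeasT × MeasT) ≃ₗ[ℝ≥0] KMS (X₀ 0 B) β :=
  LinearEquiv.ofBijective (leafMap hβ hB) (leafMap_bijective hβ hB)

theorem integral_diracT (c : ℝ≥0) (θ : T) (g : T → ℂ) :
    ∫ t, g t ∂((c • diracT θ : MeasT) : Measure T) = (c : ℝ) * g θ := by
  rw [FiniteMeasure.toMeasure_smul, integral_smul_nnreal_measure, NNReal.smul_def,
    Complex.real_smul]
  congr 1
  exact integral_dirac g θ

/-- Extremality passes through `leafEquiv` to pairs of measures: one component is zero and the other
a positive multiple of a Dirac measure. -/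
theorem isExtremal_KMS_iff {B β : ℝ} (hβ : 0 < β) (hB : 0 < B) (φ : Functional) :
    IsExtremal (KMS (X₀ 0 B) β) φ ↔ ∃ c : ℝ, 0 < c ∧ ∃ θ : T,
      (∀ f : Test, φ f = c * leafFun 1 θ (B * β) f) ∨
      (∀ f : Test, φ f = c * leafFun (-1) θ (B * β) f) := by
  have hpos (c : ℝ≥0) (θ : T) (f : Test) :
      (leafMap hβ hB (c • diracT θ, 0) : Functional) f = (c : ℝ) * leafFun 1 θ (B * β) f := by
    rw [leafMap_apply, integral_diracT]
    simp
  have hneg (c : ℝ≥0) (θ : T) (f : Test) :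
      (leafMap hβ hB (0, c • diracT θ) : Functional) f = (c : ℝ) * leafFun (-1) θ (B * β) f := by
    rw [leafMap_apply, integral_diracT]
    simp
  have hext (ν : MeasT × MeasT) : IsExtremal (KMS (X₀ 0 B) β) (leafMap hβ hB ν) ↔
      (IsExtremalVec ν.1 ∧ ν.2 = 0) ∨ (ν.1 = 0 ∧ IsExtremalVec ν.2) := by
    rw [isExtremal_iff, ← isExtremalVec_prod_iff measT_add_eq_zero measT_add_eq_zero]
    exact isExtremalVec_map_iff (leafEquiv hβ hB)
  constructor
  · intro h
    obtain ⟨⟨ν₁, ν₂⟩, hν⟩ := (leafMap_bijective hβ hB).2 ⟨φ, h.1⟩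
    obtain rfl : (leafMap hβ hB (ν₁, ν₂) : Functional) = φ := congrArg Subtype.val hν
    rcases (hext _).mp h with ⟨h1, rfl⟩ | ⟨rfl, h1⟩
    · obtain ⟨c, hc, θ, rfl⟩ := (isExtremalVec_measT_iff _).mp h1
      exact ⟨c, hc, θ, Or.inl (hpos c θ)⟩
    · obtain ⟨c, hc, θ, rfl⟩ := (isExtremalVec_measT_iff _).mp h1
      exact ⟨c, hc, θ, Or.inr (hneg c θ)⟩
  · rintro ⟨c, hc, θ, h⟩
    lift c to ℝ≥0 using hc.le
    rw [NNReal.coe_pos] at hc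
    have hv : IsExtremalVec (c • diracT θ) := (isExtremalVec_measT_iff _).mpr ⟨c, hc, θ, rfl⟩
    rcases h with h | h
    · rw [show φ = leafMap hβ hB (c • diracT θ, 0) from
        LinearMap.ext fun f => (h f).trans (hpos c θ f).symm, hext]
      exact Or.inl ⟨hv, rfl⟩
    · rw [show φ = leafMap hβ hB (0, c • diracT θ) from
        LinearMap.ext fun f => (h f).trans (hneg c θ f).symm, hext]
      exact Or.inr ⟨rfl, hv⟩

theorem leafFun_mem {x B β : ℝ} (hβ : 0 < β) (hB : 0 < B) (hx : x ≠ 0) (θ : T) :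
    ∃ φ ∈ KMS (X₀ 0 B) β, ∀ f : Test, φ f = leafFun x θ (B * β) f :=
  ⟨_, leafFunctional_mem hx hβ (mul_pos hB hβ) (Measure.dirac θ), fun f => by
    rw [leafFunctional_apply, integral_dirac]⟩

theorem KMS_eq_bot_of_equiv {X Y : VF} {β : ℝ} (e : KMS X β ≃ₗ[ℝ≥0] KMS Y β) (h : KMS X β = ⊥) :
    KMS Y β = ⊥ := by
  refine (Submodule.eq_bot_iff _).mpr fun φ hφ => ?_
  have h1 : e.symm ⟨φ, hφ⟩ = 0 :=
    Subtype.ext ((Submodule.eq_bot_iff _).mp h _ (e.symm ⟨φ, hφ⟩).2)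
  exact congrArg Subtype.val ((LinearEquiv.map_eq_zero_iff _).mp h1)

end Spiral

/-! ### Assembly of the theorem -/

open Spiral in
theorem mainTheorem4 (β : ℝ) (hβ : 0 < β) :
    -- the table, for every representative `X` of the class `[A ∂_θ + B ∂_y]`
    (∀ (A B : ℝ) (X : poissonVF), cls X = cls (X₀ A B) →
      (B < 0 → KMS X β = ⊥) ∧
      (B = 0 → Nonempty (ℝ≥0 ≃ₗ[ℝ≥0] KMS X β)) ∧
      (0 < B → A ≠ 0 → KMS X β = ⊥) ∧
      (0 < B → A = 0 → Nonempty ((MeasT × MeasT) ≃ₗ[ℝ≥0] KMS X β))) ∧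
    -- the ray for `B = 0`
    (∀ A : ℝ, ∃ e : ℝ≥0 ≃ₗ[ℝ≥0] KMS (X₀ A 0) β, ∀ (c : ℝ≥0) (f : Test),
      (e c : Functional) f = (c : ℂ) * ∫ θ in (0 : ℝ)..(2 * Real.pi), ∫ y : ℝ,
        f.1 (0, (θ : T), y) * (Real.exp (-(A * β * y)) : ℂ)) ∧
    -- the positive Poisson traces
    (∃ e : ℝ≥0 ≃ₗ[ℝ≥0] poissonTraces, ∀ (c : ℝ≥0) (f : Test),
      (e c : Functional) f = (c : ℂ) * ∫ θ in (0 : ℝ)..(2 * Real.pi), ∫ y : ℝ,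
        f.1 (0, (θ : T), y)) ∧
    -- the case `A = 0`, `B > 0`; for `B = 1` this is `[∂_y]`
    (∀ B : ℝ, 0 < B →
      (∀ (x : ℝ) (θ : T), x ≠ 0 →
        (∀ f : Test, Integrable (leafIntegrand x θ (B * β) f)) ∧
        ∃ φ ∈ KMS (X₀ 0 B) β, ∀ f : Test, φ f = leafFun x θ (B * β) f) ∧
      (∃ e : (MeasT × MeasT) ≃ₗ[ℝ≥0] KMS (X₀ 0 B) β, ∀ (ν : MeasT × MeasT) (f : Test),
        Integrable (fun θ => leafFun 1 θ (B * β) f) (ν.1 : Measure T) ∧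
        Integrable (fun θ => leafFun (-1) θ (B * β) f) (ν.2 : Measure T) ∧
        (e ν : Functional) f =
          (∫ θ, leafFun 1 θ (B * β) f ∂(ν.1 : Measure T)) +
          ∫ θ, leafFun (-1) θ (B * β) f ∂(ν.2 : Measure T)) ∧
      (∀ φ : Functional, IsExtremal (KMS (X₀ 0 B) β) φ ↔
        ∃ c : ℝ, 0 < c ∧ ∃ θ : T,
          (∀ f : Test, φ f = c * leafFun 1 θ (B * β) f) ∨
          (∀ f : Test, φ f = c * leafFun (-1) θ (B * β) f))) := by
  refine ⟨fun A B X hX => ?_, fun A => exists_rayEquiv A hβ, ?_, fun B hB => ⟨fun x θ hx =>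
    ⟨integrable_leafIntegrand hx (mul_pos hB hβ) θ, leafFun_mem hβ hB hx θ⟩,
    ⟨leafEquiv hβ hB, fun ν f => ⟨integrable_leafFun one_ne_zero (mul_pos hB hβ) _ f,
      integrable_leafFun neg_one_ne_zero_real (mul_pos hB hβ) _ f,
      leafMap_apply hβ hB ν f⟩⟩, isExtremal_KMS_iff hβ hB⟩⟩
  · obtain ⟨h, hh⟩ := (cls_eq_iff X (X₀ A B)).mp hX
    rw [hh]
    have e := KMSEquiv (X₀ A B) β h
    refine ⟨fun hB => KMS_eq_bot_of_equiv e (KMS_X₀_eq_bot hβ (Or.inl hB)), ?_,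
      fun hB hA => KMS_eq_bot_of_equiv e (KMS_X₀_eq_bot hβ (Or.inr ⟨hB, hA⟩)), ?_⟩
    · rintro rfl
      obtain ⟨e', -⟩ := exists_rayEquiv A hβ
      exact ⟨e'.trans e⟩
    · rintro hB rfl
      exact ⟨(leafEquiv hβ hB).trans e⟩
  · rw [poissonTraces_eq β]
    simpa using exists_rayEquiv 0 hβ
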